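/- **Corollary (finite Blaschke products).** For $0<\rho\le 1$ put $C_\rho=\{|\lambda|=\rho\}$, $I_\rho=\{|\lambda|<\rho\}$ and $A_\rho=\{\rho<|\lambda|<1/\rho\}$. Fix $r\in(0,1]$. A map $g$ into $2\times 2$ matrices is *twisted* if $\sigma_3\,g(-\lambda)\,\sigma_3^{-1}=g(\lambda)$ with $\sigma_3=\mathrm{diag}[1,-1]$, and $g^*(\lambda):=\overline{g(1/\bar\lambda)}^{\,t}$. Let $\Lambda_r^+\mathrm{SL}_\sigma$ be the group of twisted loops $g:C_r\to \mathrm{SL}(2,\mathbb C)$ (smooth, or more generally of class $C^n$ for any fixed $n\in\{0,1,\dots,\infty\}$) that are the boundary values of a holomorphic map on $I_r$. Let $\Lambda_{\mathbb C^*}\mathrm{SU}_\sigma$ be the group of twisted holomorphic maps $\mathbb C^*\to \mathrm{SL}(2,\mathbb C)$ with values in $\mathrm{SU}(2)$ on the unit circle; a loop on $C_r$ belongs to it if it is the restriction of such a map. For $q\in\mathbb C^*$ let $$\chi_c(\tau_q)(\lambda)=\exp\Big((q\lambda^{-1}-\bar q\lambda)\begin{pmatrix}0&1\\1&0\end{pmatrix}\Big),\qquad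 \mathcal S_r^q=\{\lambda\in A_r:\ q\lambda^{-1}-\bar q\lambda\in\pi i\mathbb Z\}.$$ Let $h=\mathrm{diag}[a,1/a]\in\Lambda_r^+\mathrm{SL}_\sigma$. Then the following are equivalent. (i) $h$ has an extension to $A_{r'}$ for some $r'\in[r,1]$ (with $r'<1$ if $r<1$) such that $h^*=h^{-1}$ on $A_{r'}$, and $h\,\chi_c(\tau_q)\,h^{-1}\in\Lambda_{\mathbb C^*}\mathrm{SU}_\sigma$. Here an extension to $A_{r'}$ means a holomorphic map on some connected open set $U\supseteq I_r\cup A_{r'}$ that on $I_r$ is the holomorphic extension of $h$. (ii) $a^2$ is a finite Blaschke product: there are $N\ge 0$, a constant $c$ with $|c|=1$, and points $\alpha_1,\dots,\alpha_N\in\mathcal S_r^q$ with pairwise distinct squares $\alpha_j^2$, such that for all $\lambda\in C_r$ $$a^2(\lambda)=c\prod_{j=1}^N\frac{\alpha_j^2-\lambda^2}{1-\bar\alpha_j^2\lambda^2}.$$ (The $\alpha_j$ may lie inside, on, or outside the unit circle.) -/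

import Mathlib

open Filter Topology
open scoped Matrix ComplexConjugate

namespace CylinderDressing

/-- Complex `2 × 2` matrices. A loop on the circle `C_r = {‖z‖ = r}` is represented by a map
`ℂ → Mat` of which only the values on `C_r` are used. -/
abbrev Mat : Type := Matrix (Fin 2) (Fin 2) ℂ

/-- The open annulus `A_r = {r < |z| < 1/r}`; it is empty for `r = 1`. -/
def annulus (r : ℝ) : Set ℂ := {z | r < ‖z‖ ∧ ‖z‖ < 1 / r}

/-- Entrywise holomorphy of a matrix valued map (used on open sets). -/
def HolomorphicOn (g : ℂ → Mat) (U : Set ℂ) : Prop :=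
  ∀ i j, DifferentiableOn ℂ (fun z => g z i j) U

/-- `σ₃ = diag[1, -1]`. -/
def sigma3 : Mat := !![1, 0; 0, -1]

/-- The twisting involution `(σ g)(z) = σ₃ g(-z) σ₃⁻¹`. -/
noncomputable def twist (g : ℂ → Mat) : ℂ → Mat := fun z => sigma3 * g (-z) * sigma3⁻¹

/-- `g^*(z)` is the conjugate transpose of `g(1 / z̄)`. -/
noncomputable def loopStar (g : ℂ → Mat) : ℂ → Mat := fun z => (g (1 / conj z))ᴴ

/-- The twisted loop group `Λ_r SL(2,ℂ)_σ`, of loops of class `C^n`. The choice `n = ∞` gives the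
smooth loops, and `n = 0` contains all loops with entries in a Sobolev algebra `H^s`, `s > 1/2`,
or in a Wiener algebra. -/
structure IsTwistedLoop (n : ℕ∞) (r : ℝ) (g : ℂ → Mat) : Prop where
  contDiff : ∀ i j, ContDiff ℝ n (fun θ : ℝ => g (circleMap 0 r θ) i j)
  det_eq_one : ∀ z ∈ Metric.sphere (0 : ℂ) r, (g z).det = 1
  twisted : ∀ z ∈ Metric.sphere (0 : ℂ) r, twist g z = g z

/-- `G` is, on the disc `I_r = {|z| < r}`, the analytic extension of the loop `g` on `C_r`:
it is holomorphic there and has `g` as its boundary values. -/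
def IsDiscExtension (r : ℝ) (g G : ℂ → Mat) : Prop :=
  HolomorphicOn G (Metric.ball 0 r) ∧
    ∀ z ∈ Metric.sphere (0 : ℂ) r, Tendsto G (𝓝[Metric.ball 0 r] z) (𝓝 (g z))

/-- The subgroup `Λ_r⁺ SL(2,ℂ)_σ` of loops that extend analytically to the disc `I_r`. -/
def LambdaPlus (n : ℕ∞) (r : ℝ) : Set (ℂ → Mat) :=
  {g | IsTwistedLoop n r g ∧ ∃ G, IsDiscExtension r g G}

/-- Twisted `SL(2,ℂ)`-valued holomorphic maps on `ℂ^*` with values in `SU(2)` on the unit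
circle. -/
structure IsTwistedUnitaryOnPunctured (g : ℂ → Mat) : Prop where
  holomorphic : HolomorphicOn g {0}ᶜ
  det_eq_one : ∀ z, z ≠ 0 → (g z).det = 1
  twisted : ∀ z, z ≠ 0 → twist g z = g z
  unitary : ∀ z ∈ Metric.sphere (0 : ℂ) 1, g z ∈ Matrix.specialUnitaryGroup (Fin 2) ℂ

/-- The loops on `C_r` that belong to `Λ_{ℂ^*} SU(2)_σ`, i.e. that are restrictions to `C_r` of
twisted holomorphic maps `ℂ^* → SL(2,ℂ)` with values in `SU(2)` on the unit circle. -/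
def LambdaPuncturedSU (r : ℝ) : Set (ℂ → Mat) :=
  {g | ∃ G, IsTwistedUnitaryOnPunctured G ∧ Set.EqOn G g (Metric.sphere 0 r)}

/-- The loop `g ∈ Λ_r⁺ SL(2,ℂ)_σ` has an extension to `A_{r'}`, for some `r' ∈ [r, 1]`, with
`g^* = g⁻¹` on `A_{r'}`. An extension is a (branch of an) analytic continuation: a holomorphic map
on some domain `U` that contains `I_r` and `A_{r'}`, and which on `I_r` is the analytic extension
of `g`. The domain `U` need not contain the whole region between `I_r` and `A_{r'}`, where there
may be branch points. For `r < 1` the (empty) annulus of `r' = 1` is not allowed. -/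
def ExtendsUnitarily (r : ℝ) (g : ℂ → Mat) : Prop :=
  ∃ r' ∈ Set.Icc r 1, (r < 1 → r' < 1) ∧
    ∃ (U : Set ℂ) (G : ℂ → Mat),
      IsOpen U ∧ IsConnected U ∧ Metric.ball 0 r ⊆ U ∧ annulus r' ⊆ U ∧
      HolomorphicOn G U ∧ IsDiscExtension r g G ∧
      ∀ z ∈ annulus r', loopStar G z = (G z)⁻¹

/-- `A = off[1, 1]`. -/
def matA : Mat := !![0, 1; 1, 0]

/-- The extended unitary frame `F_c(w, λ) = exp((w λ⁻¹ - w̄ λ) A)` of the round cylinder. -/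
noncomputable def cylinderFrame (w l : ℂ) : Mat :=
  NormedSpace.exp ((w * l⁻¹ - conj w * l) • matA)

/-- The monodromy `χ_c(τ_q) = exp((q λ⁻¹ - q̄ λ) A)` of the round cylinder with respect to the
translation `τ_q : w ↦ w + q`. -/
noncomputable def cylinderMonodromy (q : ℂ) : ℂ → Mat :=
  fun l => NormedSpace.exp ((q * l⁻¹ - conj q * l) • matA)

/-- `χ_c(τ_q)` is indeed the monodromy: `τ_q^* F_c = χ_c(τ_q) F_c`. -/
theorem cylinderFrame_translate (q w l : ℂ) :
    cylinderFrame (w + q) l = cylinderMonodromy q l * cylinderFrame w l := by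
  unfold cylinderFrame cylinderMonodromy
  rw [← Matrix.exp_add_of_commute]
  · rw [← add_smul, map_add]
    congr 2
    ring
  · exact ((Commute.refl matA).smul_left _).smul_right _

/-- The spectral set `S_r^q = {λ ∈ A_r : q λ⁻¹ - q̄ λ ∈ π i ℤ}`. -/
def spectralSet (r : ℝ) (q : ℂ) : Set ℂ :=
  {l | l ∈ annulus r ∧ ∃ k : ℤ, q * l⁻¹ - conj q * l = Real.pi * Complex.I * k}

/-- The loop `diag[a, 1/a]`. -/
noncomputable def diagLoop (a : ℂ → ℂ) : ℂ → Mat := fun z => !![a z, 0; 0, 1 / a z]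

end CylinderDressing

namespace CylinderDressing

/-! Write `S = cylSinh q`. Conjugation by diag[a, 1/a] keeps the diagonal cosh entries of the
monodromy and turns the off-diagonal ones into b = a² S and g = a⁻² S. Everything is therefore a
statement about a², and a² = b/S = S/g.

From the dressing condition to the product: b and g continue holomorphically to the punctured plane,
with b g = S², g odd and b^* = -g. A zero of S off the unit circle is simple, because the derivative
of the exponent vanishes only where |λ| = 1. So at such a point the orders of b and g are (2,0),
(1,1) or (0,2), and b/S has a simple zero, neither zero nor pole, or a simple pole. Zeros and poles
are exchanged by λ ↦ 1/λ̄ and each set is symmetric under λ ↦ -λ. The unitary extension makes a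
holomorphic and zero free near the unit circle, where S may have double zeros, and near the origin,
where b and S may be essentially singular. Dividing a² by the Blaschke product over its finitely
many zeros leaves an entire zero free function of modulus one on the unit circle, hence a constant
(`exists_blaschke_of_extension`, `exists_eqOn_const_of_norm_eq_one`). For r = 1 the annulus is
empty; there unitarity itself gives |a| = 1 on the circle and a² is constant
(`const_of_boundary_unitary`).

From the product to the dressing condition: if a² = c P/Q, the roots of P and of Q are zeros of S,
so S = P k = Q h, and b = c P h, g = c̄ Q k are the required continuations
(`mem_punctured_of_blaschke`). Extending a itself needs a square root of P/Q on a connected domain.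
Factors with |α| = 1 are constant; the others have roots on a thin annulus free of zeros and poles,
and on the disc together with a sector avoiding all branch points. The two roots are glued along a
connected overlap (`extendsUnitarily_of_blaschke`). -/

/-- The exponent `q z⁻¹ - q̄ z` of the monodromy of the round cylinder. -/
noncomputable def cylExponent (q z : ℂ) : ℂ := q * z⁻¹ - conj q * z

/-- The hyperbolic sine of the exponent, i.e. the off-diagonal entry of the monodromy. -/
noncomputable def cylSinh (q z : ℂ) : ℂ := Complex.sinh (cylExponent q z)

/-! ### The monodromy matrix, and the symmetries and zeros of its off-diagonal entry. -/

theorem exp_smul_matA (w : ℂ) :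
    NormedSpace.exp (w • matA) =
      !![Complex.cosh w, Complex.sinh w; Complex.sinh w, Complex.cosh w] := by
  have hT : IsUnit (!![1, 1; 1, -1] : Mat) := by
    rw [Matrix.isUnit_iff_isUnit_det]
    norm_num [Matrix.det_fin_two]
  have hdiag : ∀ x y : ℂ, Matrix.diagonal ![x, y] = (!![x, 0; 0, y] : Mat) := fun x y => by
    ext i j; fin_cases i <;> fin_cases j <;> rfl
  have hinv : (!![1, 1; 1, -1] : Mat)⁻¹ = !![1/2, 1/2; 1/2, -1/2] := by
    apply Matrix.inv_eq_right_inv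
    ext i j; fin_cases i <;> fin_cases j <;> norm_num [Matrix.mul_apply, Fin.sum_univ_two]
  have h1 : w • matA =
      !![1, 1; 1, -1] * Matrix.diagonal ![w, -w] * (!![1, 1; 1, -1] : Mat)⁻¹ := by
    rw [hinv, hdiag]
    ext i j; fin_cases i <;> fin_cases j <;>
      simp [matA, Matrix.mul_apply, Fin.sum_univ_two] <;> ring
  rw [h1, Matrix.exp_conj _ _ hT, Matrix.exp_diagonal, hinv]
  have h2 : (NormedSpace.exp ![w, -w] : Fin 2 → ℂ) = ![Complex.exp w, Complex.exp (-w)] := by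
    ext i
    rw [Pi.coe_exp]
    fin_cases i <;> simp [Complex.exp_eq_exp_ℂ]
  rw [h2, hdiag]
  ext i j; fin_cases i <;> fin_cases j <;>
    simp [Matrix.mul_apply, Fin.sum_univ_two, Complex.cosh, Complex.sinh] <;> ring

theorem cylinderMonodromy_eq (q l : ℂ) :
    cylinderMonodromy q l = !![Complex.cosh (cylExponent q l), cylSinh q l;
      cylSinh q l, Complex.cosh (cylExponent q l)] :=
  exp_smul_matA _

theorem diagLoop_mul_cylinderMonodromy_mul_inv (q l : ℂ) (a : ℂ → ℂ) (h : a l ≠ 0) :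
    diagLoop a l * cylinderMonodromy q l * (diagLoop a l)⁻¹ =
      !![Complex.cosh (cylExponent q l), a l ^ 2 * cylSinh q l;
        (a l ^ 2)⁻¹ * cylSinh q l, Complex.cosh (cylExponent q l)] := by
  have hinv : (diagLoop a l)⁻¹ = !![1 / a l, 0; 0, a l] := by
    apply Matrix.inv_eq_right_inv
    ext i j; fin_cases i <;> fin_cases j <;> simp [diagLoop, Matrix.mul_apply, Fin.sum_univ_two, h]
  rw [hinv, cylinderMonodromy_eq]
  ext i j; fin_cases i <;> fin_cases j <;>
    simp [diagLoop, Matrix.mul_apply, Fin.sum_univ_two] <;> field_simp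

@[simp] theorem cylExponent_neg (q z : ℂ) : cylExponent q (-z) = -cylExponent q z := by
  simp [cylExponent, inv_neg]; ring

@[simp] theorem cylSinh_neg (q z : ℂ) : cylSinh q (-z) = -cylSinh q z := by
  simp [cylSinh]

theorem cylExponent_one_div_conj (q z : ℂ) :
    cylExponent q (1 / conj z) = -conj (cylExponent q z) := by
  simp [cylExponent]

theorem cylSinh_one_div_conj (q z : ℂ) : cylSinh q (1 / conj z) = -conj (cylSinh q z) := by
  rw [cylSinh, cylExponent_one_div_conj, Complex.sinh_neg, cylSinh, Complex.sinh_conj]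

theorem hasDerivAt_cylExponent (q : ℂ) {z : ℂ} (hz : z ≠ 0) :
    HasDerivAt (cylExponent q) (-q / z ^ 2 - conj q) z := by
  have := ((hasDerivAt_inv hz).const_mul q).sub ((hasDerivAt_id z).const_mul (conj q))
  convert! this using 1
  field_simp

theorem differentiableOn_cylExponent (q : ℂ) : DifferentiableOn ℂ (cylExponent q) {0}ᶜ :=
  fun _ hz => (hasDerivAt_cylExponent q hz).differentiableAt.differentiableWithinAt

theorem differentiableOn_cylSinh (q : ℂ) : DifferentiableOn ℂ (cylSinh q) {0}ᶜ :=
  (differentiableOn_cylExponent q).csinh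

theorem analyticOnNhd_cylSinh (q : ℂ) : AnalyticOnNhd ℂ (cylSinh q) {0}ᶜ :=
  (differentiableOn_cylSinh q).analyticOnNhd isOpen_compl_singleton

theorem isPreconnected_compl_zero : IsPreconnected ({0}ᶜ : Set ℂ) :=
  (isConnected_compl_singleton_of_one_lt_rank (by simp) 0).isPreconnected

/-- Where sinh vanishes cosh² = 1, so a multiple zero needs a critical point of the exponent, i.e.
-q = q̄ p², and this forces |p| = 1. -/
theorem deriv_cylSinh_ne_zero {q p : ℂ} (hq : q ≠ 0) (hp : p ≠ 0) (hp1 : ‖p‖ ≠ 1)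
    (h : cylSinh q p = 0) : deriv (cylSinh q) p ≠ 0 := by
  have hd := (hasDerivAt_cylExponent q hp).csinh
  have hd' : HasDerivAt (cylSinh q) _ p := hd
  rw [hd'.deriv]
  apply mul_ne_zero
  · intro hc
    have := Complex.cosh_sq_sub_sinh_sq (cylExponent q p)
    rw [cylSinh] at h
    rw [h, hc] at this
    norm_num at this
  · intro h0
    have h1 : -q = conj q * p ^ 2 := by
      field_simp at h0
      linear_combination h0
    have h2 := congrArg norm h1
    rw [norm_neg, norm_mul, norm_pow, RCLike.norm_conj] at h2
    have h3 : ‖p‖ ^ 2 = 1 := by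
      have : ‖q‖ ≠ 0 := norm_ne_zero_iff.2 hq
      field_simp at h2
      exact h2.symm
    exact hp1 ((pow_eq_one_iff_of_nonneg (norm_nonneg p) two_ne_zero).1 h3)

theorem eventually_cylSinh_ne_zero {q p : ℂ} (hq : q ≠ 0) (hp : p ≠ 0) :
    ∀ᶠ z in 𝓝[≠] p, cylSinh q z ≠ 0 := by
  by_contra hcon
  have hz := (analyticOnNhd_cylSinh q).eqOn_zero_of_preconnected_of_frequently_eq_zero
    isPreconnected_compl_zero (z₀ := p) hp ((Filter.not_eventually.1 hcon).mono fun _ h => not_not.1 h)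
  have h2 : (2 : ℂ) ∈ ({0}ᶜ : Set ℂ) := by simp
  refine deriv_cylSinh_ne_zero hq (p := 2) (by simp) (by simp) (hz h2) ?_
  have : cylSinh q =ᶠ[𝓝 2] fun _ => 0 := hz.eventuallyEq_of_mem (isOpen_compl_singleton.mem_nhds h2)
  rw [this.deriv_eq]; simp

/-! ### Identity theorems and the maximum principle, starting from a circle. -/

theorem tendsto_circleMap_nhdsNE {r : ℝ} (hr : r ≠ 0) (θ : ℝ) :
    Tendsto (circleMap 0 r) (𝓝[≠] θ) (𝓝[≠] (circleMap 0 r θ)) :=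
  (hasDerivAt_circleMap 0 r θ).tendsto_nhdsNE (by simp [hr])

theorem frequently_mem_sphere {r : ℝ} (hr : 0 < r) :
    ∃ᶠ z in 𝓝[≠] (r : ℂ), z ∈ Metric.sphere (0 : ℂ) r := by
  have h := tendsto_circleMap_nhdsNE hr.ne' 0
  have h0 : circleMap 0 r 0 = (r : ℂ) := by simp [circleMap]
  rw [h0] at h
  exact h.frequently (Eventually.of_forall fun θ => circleMap_mem_sphere _ hr.le θ).frequently

theorem eqOn_compl_zero_of_eqOn_sphere {g h : ℂ → ℂ} {r : ℝ} (hr : 0 < r)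
    (hg : DifferentiableOn ℂ g {0}ᶜ) (hh : DifferentiableOn ℂ h {0}ᶜ)
    (heq : Set.EqOn g h (Metric.sphere 0 r)) : Set.EqOn g h {0}ᶜ :=
  (hg.analyticOnNhd isOpen_compl_singleton).eqOn_of_preconnected_of_frequently_eq
    (hh.analyticOnNhd isOpen_compl_singleton) isPreconnected_compl_zero (z₀ := (r : ℂ))
    (by simpa using hr.ne') ((frequently_mem_sphere hr).mono fun _ hz => heq hz)

theorem finite_cylSinh_zeros {q : ℂ} (hq : q ≠ 0) {r : ℝ} (hr : 0 < r) :
    {z : ℂ | (r ≤ ‖z‖ ∧ ‖z‖ ≤ 1 / r) ∧ cylSinh q z = 0}.Finite := by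
  by_contra hinf
  have hK : IsCompact {z : ℂ | r ≤ ‖z‖ ∧ ‖z‖ ≤ 1 / r} := by
    apply Metric.isCompact_of_isClosed_isBounded
    · exact (isClosed_le continuous_const continuous_norm).inter
        (isClosed_le continuous_norm continuous_const)
    · refine (Metric.isBounded_closedBall (x := (0 : ℂ)) (r := 1 / r)).subset fun z hz => ?_
      simpa using hz.2
  obtain ⟨p, hp, hacc⟩ := Set.Infinite.exists_accPt_of_subset_isCompact hinf hK fun z hz => hz.1
  have hp0 : p ≠ 0 := norm_pos_iff.1 (hr.trans_le hp.1)
  rw [accPt_iff_frequently_nhdsNE] at hacc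
  exact hacc ((eventually_cylSinh_ne_zero hq hp0).mono fun z hz h => hz h.2)

/-- A holomorphic function on a punctured disc that vanishes on the outer boundary is zero. -/
theorem eqOn_zero_of_tendsto_zero_sphere {D : ℂ → ℂ} {r : ℝ}
    (hD : DifferentiableOn ℂ D (Metric.ball 0 r \ {0}))
    (hb : ∀ z ∈ Metric.sphere (0 : ℂ) r, Tendsto D (𝓝[Metric.ball 0 r] z) (𝓝 0)) :
    ∀ z ∈ Metric.ball (0 : ℂ) r \ {0}, D z = 0 := by
  classical
  rintro z ⟨hz, hz0⟩
  have hz0 : 0 < ‖z‖ := norm_pos_iff.2 hz0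
  have hzr : ‖z‖ < r := by simpa using hz
  set e := ‖z‖ / 2 with he
  have he0 : 0 < e := by positivity
  set V : Set ℂ := Metric.ball 0 r \ Metric.closedBall 0 e with hV
  have hVo : IsOpen V := Metric.isOpen_ball.sdiff Metric.isClosed_closedBall
  -- Extending by the boundary value 0 gives a function continuous up to the outer circle.
  set E : ℂ → ℂ := fun w => if ‖w‖ < r then D w else 0 with hE
  have hEball : ∀ w ∈ Metric.ball (0 : ℂ) r, E w = D w := fun w hw => if_pos (by simpa using hw)
  have hcl : closure V ⊆ {w | e ≤ ‖w‖ ∧ ‖w‖ ≤ r} := by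
    apply closure_minimal
    · rintro w ⟨h1, h2⟩
      simp at h1 h2
      exact ⟨h2.le, h1.le⟩
    · exact (isClosed_le continuous_const continuous_norm).inter
        (isClosed_le continuous_norm continuous_const)
  have hdiffball : ∀ w ∈ Metric.ball (0 : ℂ) r \ {0}, DifferentiableAt ℂ E w := by
    intro w hw
    have : E =ᶠ[𝓝 w] D :=
      Filter.eventuallyEq_of_mem (Metric.isOpen_ball.mem_nhds hw.1) hEball
    exact this.differentiableAt_iff.2
      (hD.differentiableAt ((Metric.isOpen_ball.sdiff isClosed_singleton).mem_nhds hw))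
  have hcont : ∀ w ∈ closure V, ContinuousWithinAt E (closure V) w := by
    intro w hw
    have hw' := hcl hw
    rcases hw'.2.lt_or_eq with h | h
    · refine (hdiffball w ⟨by simpa using h, ?_⟩).continuousAt.continuousWithinAt
      exact norm_pos_iff.1 (he0.trans_le hw'.1)
    · have hws : w ∈ Metric.sphere (0 : ℂ) r := by simpa using h
      have hEw : E w = 0 := if_neg (by simp [h])
      rw [ContinuousWithinAt, hEw]
      have h1 := hb w hws
      rw [Metric.tendsto_nhdsWithin_nhds] at h1 ⊢
      intro ε hε
      obtain ⟨δ, hδ, h2⟩ := h1 ε hε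
      refine ⟨δ, hδ, fun x hx hd => ?_⟩
      by_cases hxr : ‖x‖ < r
      · rw [hEball x (by simpa using hxr)]
        exact h2 (by simpa using hxr) hd
      · simp only [hE, if_neg hxr, dist_self]; exact hε
  have hbd : Bornology.IsBounded V := Metric.isBounded_ball.subset Set.sdiff_subset
  have hcpt : IsCompact (closure V) := hbd.isCompact_closure
  have hcontOn : ContinuousOn E (closure V) := hcont
  obtain ⟨M, hM⟩ := hcpt.exists_bound_of_continuousOn hcontOn
  have hne : ∀ w ∈ closure V, w ≠ 0 := fun w hw => norm_pos_iff.1 (he0.trans_le (hcl hw).1)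
  have hdV : DifferentiableOn ℂ E V := fun w hw =>
    (hdiffball w ⟨hw.1, hne w (subset_closure hw)⟩).differentiableWithinAt
  have hzV : z ∈ V := ⟨hz, by simp; linarith⟩
  have hM0 : 0 ≤ M := (norm_nonneg _).trans (hM z (subset_closure hzV))
  -- The singularity at 0 is uncontrolled, so the inner circle |w| = e = |z|/2 contributes the bound
  -- M. The weight w^k suppresses it: the maximum principle for w^k D gives |z|^k |D z| ≤ e^k M.
  have key : ∀ k : ℕ, ‖D z‖ ≤ (1 / 2) ^ k * M := by
    intro k
    have hmax := Complex.norm_le_of_forall_mem_frontier_norm_le (f := fun w => w ^ k * E w)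
      (C := e ^ k * M) hbd
      ⟨((differentiable_id.pow k).differentiableOn).mul hdV,
        ((continuous_id.pow k).continuousOn).mul hcontOn⟩ (fun w hw => ?_) (subset_closure hzV)
    · rw [hEball z hz, norm_mul, norm_pow] at hmax
      have : ‖D z‖ ≤ e ^ k * M / ‖z‖ ^ k := by
        rw [le_div_iff₀ (by positivity)]; linarith
      refine this.trans_eq ?_
      rw [he, div_pow, div_pow, one_pow]
      have : ‖z‖ ^ k ≠ 0 := by positivity
      field_simp
    · have hwc : w ∈ closure V := hw.1
      have hnV : w ∉ V := by
        intro h; exact hw.2 (by rwa [hVo.interior_eq])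
      by_cases hwr : ‖w‖ < r
      · have hwe : ‖w‖ ≤ e := by
          by_contra h
          exact hnV ⟨by simpa using hwr, by simpa using h⟩
        rw [norm_mul, norm_pow]
        gcongr
        exact hM w hwc
      · simp only [hE, if_neg hwr, mul_zero, norm_zero]; positivity
  have hlim : Tendsto (fun k : ℕ => (1 / 2 : ℝ) ^ k * M) atTop (𝓝 (0 * M)) :=
    (tendsto_pow_atTop_nhds_zero_of_lt_one (by norm_num) (by norm_num)).mul_const M
  have := ge_of_tendsto' hlim key
  rw [zero_mul] at this
  exact norm_le_zero_iff.1 this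

theorem eqOn_ball_of_eqOn_punctured_ball {g h : ℂ → ℂ} {r : ℝ} (hr : 0 < r)
    (hg : ContinuousAt g 0) (hh : ContinuousAt h 0)
    (heq : ∀ z ∈ Metric.ball (0 : ℂ) r \ {0}, g z = h z) :
    ∀ z ∈ Metric.ball (0 : ℂ) r, g z = h z := by
  intro z hz
  rcases eq_or_ne z 0 with rfl | h0
  · have h1 : Tendsto g (𝓝[≠] 0) (𝓝 (g 0)) := hg.mono_left nhdsWithin_le_nhds
    have h2 : Tendsto h (𝓝[≠] 0) (𝓝 (h 0)) := hh.mono_left nhdsWithin_le_nhds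
    refine tendsto_nhds_unique (h1.congr' ?_) h2
    filter_upwards [self_mem_nhdsWithin, mem_nhdsWithin_of_mem_nhds (Metric.ball_mem_nhds 0 hr)]
      with w hw hw' using heq w ⟨hw', hw⟩
  · exact heq z ⟨hz, h0⟩

/-- A zero free holomorphic function on the unit disc with unimodular boundary values is
constant. -/
theorem exists_eqOn_const_of_norm_eq_one {K : ℂ → ℂ} (hK : DiffContOnCl ℂ K (Metric.ball 0 1))
    (hne : ∀ z ∈ Metric.closedBall (0 : ℂ) 1, K z ≠ 0)
    (h1 : ∀ z ∈ Metric.sphere (0 : ℂ) 1, ‖K z‖ = 1) :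
    ∃ c : ℂ, ‖c‖ = 1 ∧ ∀ z ∈ Metric.closedBall (0 : ℂ) 1, K z = c := by
  have hfr : frontier (Metric.ball (0 : ℂ) 1) = Metric.sphere 0 1 := frontier_ball _ one_ne_zero
  have hcl : closure (Metric.ball (0 : ℂ) 1) = Metric.closedBall 0 1 := closure_ball _ one_ne_zero
  have hle : ∀ z ∈ Metric.closedBall (0 : ℂ) 1, ‖K z‖ ≤ 1 := fun z hz =>
    Complex.norm_le_of_forall_mem_frontier_norm_le Metric.isBounded_ball hK
      (fun w hw => (h1 w (hfr ▸ hw)).le) (hcl ▸ hz)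
  -- The maximum principle applies to 1/K as well, so |K| is identically 1 and K is constant.
  have hge : ∀ z ∈ Metric.closedBall (0 : ℂ) 1, ‖(K z)⁻¹‖ ≤ 1 := fun z hz =>
    Complex.norm_le_of_forall_mem_frontier_norm_le (f := K⁻¹) Metric.isBounded_ball
      (hK.inv (fun w hw => hne w (hcl ▸ hw)))
      (fun w hw => by simp [h1 w (hfr ▸ hw)]) (hcl ▸ hz)
  have h0 : (0 : ℂ) ∈ Metric.closedBall (0 : ℂ) 1 := by simp
  have heq : ∀ z ∈ Metric.closedBall (0 : ℂ) 1, ‖K z‖ = 1 := by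
    intro z hz
    refine le_antisymm (hle z hz) ?_
    have h := hge z hz
    rw [norm_inv] at h
    exact (inv_le_one₀ (norm_pos_iff.2 (hne z hz))).1 h
  refine ⟨K 0, heq 0 h0, fun z hz => ?_⟩
  have := Complex.eqOn_closedBall_of_isMaxOn_norm (f := K) (z := 0) (r := 1) hK
    (fun w hw => by
      simp only [Set.mem_ofPred_eq, Function.comp]
      rw [heq w (Metric.ball_subset_closedBall hw), heq 0 h0])
  exact this hz

theorem ne_zero_of_isTwistedLoop_diagLoop {n : ℕ∞} {r : ℝ} {a : ℂ → ℂ}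
    (h : IsTwistedLoop n r (diagLoop a)) {z : ℂ} (hz : z ∈ Metric.sphere (0 : ℂ) r) : a z ≠ 0 := by
  intro h0
  have := h.det_eq_one z hz
  simp [diagLoop, Matrix.det_fin_two, h0] at this

theorem sigma3_inv : sigma3⁻¹ = sigma3 := by
  apply Matrix.inv_eq_right_inv
  ext i j; fin_cases i <;> fin_cases j <;> simp [sigma3, Matrix.mul_apply, Fin.sum_univ_two]

theorem tendsto_apply {ι : Type*} {l : Filter ι} {G : ι → Mat} {M : Mat}
    (h : Tendsto G l (𝓝 M)) (i j : Fin 2) : Tendsto (fun z => G z i j) l (𝓝 (M i j)) :=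
  ((continuous_apply j).tendsto _).comp (((continuous_apply i).tendsto _).comp h)

theorem conj_one_div_conj_eq {z : ℂ} (hz : ‖z‖ = 1) : 1 / conj z = z := by
  have hz0 : z ≠ 0 := norm_pos_iff.1 (by rw [hz]; norm_num)
  have : conj z ≠ 0 := by simpa using hz0
  rw [div_eq_iff this, Complex.mul_conj, Complex.normSq_eq_norm_sq, hz]
  simp

theorem differentiableOn_conj_comp_one_div_conj {g : ℂ → ℂ} (hg : DifferentiableOn ℂ g {0}ᶜ) :
    DifferentiableOn ℂ (fun z => conj (g (1 / conj z))) {0}ᶜ := by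
  intro z hz
  have hz0 : z ≠ 0 := hz
  have h1 : DifferentiableAt ℂ g (conj z⁻¹) :=
    hg.differentiableAt (isOpen_compl_singleton.mem_nhds (by simpa using hz0))
  have h2 : DifferentiableAt ℂ (conj ∘ g ∘ conj) z⁻¹ := by
    have := h1.conj_conj
    simpa using this
  have h3 := h2.comp z (differentiableAt_inv hz0)
  refine (h3.congr_of_eventuallyEq (Eventually.of_forall fun w => ?_)).differentiableWithinAt
  simp

theorem exists_int_of_sinh_eq_zero {w : ℂ} (h : Complex.sinh w = 0) :
    ∃ k : ℤ, w = Real.pi * Complex.I * k := by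
  have h1 : Complex.sin (w * Complex.I) = 0 := by rw [Complex.sin_mul_I, h, zero_mul]
  obtain ⟨k, hk⟩ := Complex.sin_eq_zero_iff.1 h1
  refine ⟨-k, ?_⟩
  have h2 : w = -(w * Complex.I) * Complex.I := by
    rw [neg_mul, mul_assoc, Complex.I_mul_I]; ring
  rw [h2, hk]; push_cast; ring

theorem sinh_eq_zero_of_int (k : ℤ) : Complex.sinh (Real.pi * Complex.I * k) = 0 := by
  have : (Real.pi * Complex.I * k : ℂ) = (k * Real.pi : ℂ) * Complex.I := by ring
  rw [this, Complex.sinh_mul_I, Complex.sin_int_mul_pi, zero_mul]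

theorem mem_spectralSet_iff {r : ℝ} {q l : ℂ} :
    l ∈ spectralSet r q ↔ l ∈ annulus r ∧ cylSinh q l = 0 := by
  refine and_congr_right fun _ => ⟨?_, exists_int_of_sinh_eq_zero⟩
  rintro ⟨k, hk⟩
  rw [cylSinh, cylExponent, hk, sinh_eq_zero_of_int]

/-! ### From the dressing condition to a Blaschke product. -/

/-- The off-diagonal entries of a dressed monodromy that extends to the punctured plane. -/
theorem exists_offDiagonal_of_mem {r : ℝ} (hr : 0 < r) {q : ℂ} {a : ℂ → ℂ}
    (ha : ∀ z ∈ Metric.sphere (0 : ℂ) r, a z ≠ 0)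
    (h : (fun l => diagLoop a l * cylinderMonodromy q l * (diagLoop a l)⁻¹) ∈
      LambdaPuncturedSU r) :
    ∃ b g : ℂ → ℂ, DifferentiableOn ℂ b {0}ᶜ ∧ DifferentiableOn ℂ g {0}ᶜ ∧
      (∀ z, z ≠ 0 → b z * g z = cylSinh q z ^ 2) ∧
      (∀ z, z ≠ 0 → g (-z) = -g z) ∧
      (∀ z, z ≠ 0 → conj (b (1 / conj z)) = -g z) ∧
      ∀ z ∈ Metric.sphere (0 : ℂ) r,
        b z = a z ^ 2 * cylSinh q z ∧ g z = (a z ^ 2)⁻¹ * cylSinh q z := by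
  obtain ⟨G, hG, heq⟩ := h
  have hval : ∀ z ∈ Metric.sphere (0 : ℂ) r, G z =
      !![Complex.cosh (cylExponent q z), a z ^ 2 * cylSinh q z;
        (a z ^ 2)⁻¹ * cylSinh q z, Complex.cosh (cylExponent q z)] := fun z hz =>
    (heq hz).trans (diagLoop_mul_cylinderMonodromy_mul_inv q z a (ha z hz))
  have hcosh := (differentiableOn_cylExponent q).ccosh
  have h00 := eqOn_compl_zero_of_eqOn_sphere hr (hG.holomorphic 0 0) hcosh
    (fun z hz => by simp [hval z hz])
  have h11 := eqOn_compl_zero_of_eqOn_sphere hr (hG.holomorphic 1 1) hcosh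
    (fun z hz => by simp [hval z hz])
  refine ⟨fun z => G z 0 1, fun z => G z 1 0, hG.holomorphic 0 1, hG.holomorphic 1 0, ?_, ?_, ?_,
    fun z hz => by simp [hval z hz]⟩
  · intro z hz
    have hd := hG.det_eq_one z hz
    rw [Matrix.det_fin_two] at hd
    have e0 : G z 0 0 = Complex.cosh (cylExponent q z) := h00 hz
    have e1 : G z 1 1 = Complex.cosh (cylExponent q z) := h11 hz
    rw [e0, e1] at hd
    have := Complex.cosh_sq_sub_sinh_sq (cylExponent q z)
    rw [cylSinh]
    linear_combination this - hd
  · intro z hz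
    have ht := hG.twisted z hz
    have := congrFun (congrFun ht 1) 0
    rw [twist, sigma3_inv] at this
    rw [Matrix.mul_apply, Fin.sum_univ_two, Matrix.mul_apply, Matrix.mul_apply] at this
    simp only [sigma3, Fin.sum_univ_two, Matrix.of_apply, Matrix.cons_val_zero,
      Matrix.cons_val_one, zero_mul, zero_add, mul_zero, add_zero, mul_one, neg_one_mul] at this
    exact neg_eq_iff_eq_neg.1 this
  -- For a matrix in SU(2) the inverse is both the adjugate and the conjugate transpose. This gives
  -- the relation on the unit circle, and both sides are holomorphic on the punctured plane.
  · refine eqOn_compl_zero_of_eqOn_sphere one_pos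
      (differentiableOn_conj_comp_one_div_conj (hG.holomorphic 0 1)) (hG.holomorphic 1 0).neg ?_
    intro z hz
    have hz1 : ‖z‖ = 1 := by simpa using hz
    have hu := hG.unitary z hz
    rw [Matrix.mem_specialUnitaryGroup_iff, Matrix.mem_unitaryGroup_iff'] at hu
    have hinv := Matrix.inv_eq_left_inv hu.1
    rw [Matrix.inv_def, hu.2, Matrix.adjugate_fin_two] at hinv
    have h10 := congrFun (congrFun hinv 1) 0
    simp [Matrix.star_apply] at h10
    simp only [conj_one_div_conj_eq hz1]
    exact h10.symm

/-- The case r = 1. On the unit circle b^* = -g reads conj(a² S) = -a⁻² S, so |a|⁴ = 1 off the zeros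
of S, and at these isolated zeros by continuity. The disc extension is zero free, hence constant. -/
theorem const_of_boundary_unitary {n : ℕ∞} {q : ℂ} (hq : q ≠ 0) {a : ℂ → ℂ}
    (ha : diagLoop a ∈ LambdaPlus n 1)
    (h : (fun l => diagLoop a l * cylinderMonodromy q l * (diagLoop a l)⁻¹) ∈
      LambdaPuncturedSU 1) :
    ∃ c : ℂ, ‖c‖ = 1 ∧ ∀ z ∈ Metric.sphere (0 : ℂ) 1, a z ^ 2 = c := by
  obtain ⟨hloop, G, hGh, hGb⟩ := ha
  have hne : ∀ z ∈ Metric.sphere (0 : ℂ) 1, a z ≠ 0 := fun z hz =>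
    ne_zero_of_isTwistedLoop_diagLoop hloop hz
  obtain ⟨b, g, -, -, -, -, hbg, hsph⟩ := exists_offDiagonal_of_mem one_pos hne h
  have hS : ∀ z ∈ Metric.sphere (0 : ℂ) 1, cylSinh q z ≠ 0 → ‖a z‖ = 1 := by
    intro z hz hSz
    have hz1 : ‖z‖ = 1 := by simpa using hz
    have hz0 : z ≠ 0 := norm_pos_iff.1 (by rw [hz1]; norm_num)
    have h1 := hbg z hz0
    rw [conj_one_div_conj_eq hz1, (hsph z hz).1, (hsph z hz).2] at h1
    have h2 := congrArg norm h1
    rw [RCLike.norm_conj, norm_neg, norm_mul, norm_mul, norm_inv, norm_pow] at h2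
    have h3 := mul_right_cancel₀ (norm_ne_zero_iff.2 hSz) h2
    have ha0 : ‖a z‖ ≠ 0 := norm_ne_zero_iff.2 (hne z hz)
    replace h3 : ‖a z‖ ^ (2 + 2) = 1 := by rw [pow_add]; nth_rw 1 [h3]; field_simp
    exact (pow_eq_one_iff_of_nonneg (norm_nonneg _) (by norm_num)).1 h3
  have hcont : Continuous fun θ : ℝ => a (circleMap 0 1 θ) := by
    simpa [diagLoop] using (hloop.contDiff 0 0).continuous
  have hnorm : ∀ z ∈ Metric.sphere (0 : ℂ) 1, ‖a z‖ = 1 := by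
    intro z hz
    obtain ⟨θ, rfl⟩ : z ∈ Set.range (circleMap 0 1) := by rw [range_circleMap]; simpa using hz
    have h0 : circleMap 0 1 θ ≠ 0 := circleMap_ne_center one_ne_zero
    have hev : ∀ᶠ t in 𝓝[≠] θ, ‖a (circleMap 0 1 t)‖ = 1 :=
      ((tendsto_circleMap_nhdsNE one_ne_zero θ).eventually (eventually_cylSinh_ne_zero hq h0)).mono
        fun t ht => hS _ (circleMap_mem_sphere _ zero_le_one t) ht
    have h1 : Tendsto (fun t => ‖a (circleMap 0 1 t)‖) (𝓝[≠] θ) (𝓝 ‖a (circleMap 0 1 θ)‖) :=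
      (hcont.norm.tendsto θ).mono_left nhdsWithin_le_nhds
    exact tendsto_nhds_unique h1 (tendsto_const_nhds.congr' (hev.mono fun t ht => ht.symm))
  have hball : ∀ z ∈ Metric.ball (0 : ℂ) 1, G z 0 0 * G z 1 1 = 1 := by
    have hd : DifferentiableOn ℂ (fun z => G z 0 0 * G z 1 1) (Metric.ball 0 1) :=
      (hGh 0 0).mul (hGh 1 1)
    refine eqOn_ball_of_eqOn_punctured_ball one_pos
      (hd.differentiableAt (Metric.ball_mem_nhds 0 one_pos)).continuousAt
      continuousAt_const fun z hz => ?_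
    refine sub_eq_zero.1 (eqOn_zero_of_tendsto_zero_sphere (D := fun z => G z 0 0 * G z 1 1 - 1)
      ((hd.sub_const 1).mono Set.sdiff_subset) (fun w hw => ?_) z hz)
    have := ((tendsto_apply (hGb w hw) 0 0).mul (tendsto_apply (hGb w hw) 1 1)).sub_const 1
    simpa [diagLoop, hne w hw] using this
  -- The values of G on the circle itself are arbitrary; only its limits from the disc matter, so it
  -- is replaced there by these limits.
  set K : ℂ → ℂ := extendFrom (Metric.ball 0 1) (fun z => G z 0 0)
  have hlim : ∀ z ∈ Metric.sphere (0 : ℂ) 1,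
      Tendsto (fun z => G z 0 0) (𝓝[Metric.ball 0 1] z) (𝓝 (a z)) := fun z hz => by
    simpa [diagLoop] using tendsto_apply (hGb z hz) 0 0
  have hlim' : ∀ z ∈ Metric.ball (0 : ℂ) 1,
      Tendsto (fun z => G z 0 0) (𝓝[Metric.ball 0 1] z) (𝓝 (G z 0 0)) := fun z hz =>
    (hGh 0 0).continuousOn z hz
  have hsub : Metric.closedBall (0 : ℂ) 1 ⊆ closure (Metric.ball 0 1) :=
    (closure_ball _ one_ne_zero).symm.subset
  have hKball : ∀ z ∈ Metric.ball (0 : ℂ) 1, K z = G z 0 0 := fun z hz =>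
    extendFrom_eq (subset_closure hz) (hlim' z hz)
  have hKsph : ∀ z ∈ Metric.sphere (0 : ℂ) 1, K z = a z := fun z hz =>
    extendFrom_eq (hsub (Metric.sphere_subset_closedBall hz)) (hlim z hz)
  have hcases : ∀ z ∈ Metric.closedBall (0 : ℂ) 1,
      z ∈ Metric.ball (0 : ℂ) 1 ∨ z ∈ Metric.sphere (0 : ℂ) 1 := fun z hz => by
    rwa [← Set.mem_union, Metric.ball_union_sphere]
  have hdc : DiffContOnCl ℂ K (Metric.ball 0 1) := by
    refine ⟨(hGh 0 0).congr hKball, ?_⟩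
    rw [closure_ball _ one_ne_zero]
    refine continuousOn_extendFrom hsub fun z hz => ?_
    rcases hcases z hz with h | h
    exacts [⟨_, hlim' z h⟩, ⟨_, hlim z h⟩]
  obtain ⟨c, hc, hKc⟩ := exists_eqOn_const_of_norm_eq_one hdc
    (fun z hz => by
      rcases hcases z hz with h | h
      · rw [hKball z h]; exact left_ne_zero_of_mul_eq_one (hball z h)
      · rw [hKsph z h]; exact hne z h)
    (fun z hz => by rw [hKsph z hz, hnorm z hz])
  refine ⟨c ^ 2, by simp [hc], fun z hz => ?_⟩
  rw [← hKsph z hz, hKc z (Metric.sphere_subset_closedBall hz)]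

theorem analyticOrderAt_prod_sub_sq {N : ℕ} (u v : Fin N → ℂ) {p : ℂ} (hp : p ≠ 0) (j₀ : Fin N)
    (hv : v j₀ ≠ 0) (h : u j₀ = v j₀ * p ^ 2) (hne : ∀ j, j ≠ j₀ → u j ≠ v j * p ^ 2) :
    analyticOrderAt (fun z => ∏ j, (u j - v j * z ^ 2)) p = 1 := by
  have hd : ∀ T : Finset (Fin N), Differentiable ℂ (fun z : ℂ => ∏ j ∈ T, (u j - v j * z ^ 2)) :=
    fun T => Differentiable.fun_finsetProd fun j _ => by fun_prop
  have heq : (fun z : ℂ => ∏ j, (u j - v j * z ^ 2)) = fun z => (u j₀ - v j₀ * z ^ 2) *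
      ∏ j ∈ Finset.univ.erase j₀, (u j - v j * z ^ 2) := by
    ext z; exact (Finset.mul_prod_erase _ (fun j => u j - v j * z ^ 2) (Finset.mem_univ j₀)).symm
  apply AnalyticAt.analyticOrderAt_eq_one_of_zero_deriv_ne_zero
  · exact (hd _).analyticAt p
  · exact Finset.prod_eq_zero (Finset.mem_univ j₀) (by rw [h, sub_self])
  · rw [heq]
    have h1 : HasDerivAt (fun z : ℂ => u j₀ - v j₀ * z ^ 2) (-(v j₀ * (2 * p))) p := by
      simpa using ((hasDerivAt_pow 2 p).const_mul (v j₀)).const_sub (u j₀)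
    rw [(h1.fun_mul ((hd _).differentiableAt.hasDerivAt)).deriv, h, sub_self, zero_mul, add_zero]
    refine mul_ne_zero (neg_ne_zero.2 (mul_ne_zero hv (mul_ne_zero two_ne_zero hp))) ?_
    exact Finset.prod_ne_zero_iff.2 fun j hj => sub_ne_zero.2 (hne j (Finset.ne_of_mem_erase hj))

/-- A meromorphic function of order zero everywhere agrees with an entire zero free function. -/
theorem exists_entire_of_meromorphicOrderAt_eq_zero {K₀ : ℂ → ℂ}
    (hm : ∀ p, MeromorphicAt K₀ p) (h0 : ∀ p, meromorphicOrderAt K₀ p = 0) :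
    ∃ K : ℂ → ℂ, Differentiable ℂ K ∧ (∀ p, K p ≠ 0) ∧ ∀ p, AnalyticAt ℂ K₀ p → K p = K₀ p := by
  have hmo : MeromorphicOn K₀ Set.univ := fun p _ => hm p
  have hnf := meromorphicNFOn_toMeromorphicNFOn K₀ Set.univ
  have hord : ∀ p, meromorphicOrderAt (toMeromorphicNFOn K₀ Set.univ) p = 0 := fun p => by
    rw [meromorphicOrderAt_toMeromorphicNFOn hmo (Set.mem_univ p), h0]
  refine ⟨toMeromorphicNFOn K₀ Set.univ, fun p => ?_, fun p => ?_, fun p hp => ?_⟩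
  · exact ((hnf (Set.mem_univ p)).meromorphicOrderAt_nonneg_iff_analyticAt.1
      (hord p).ge).differentiableAt
  · exact (hnf (Set.mem_univ p)).meromorphicOrderAt_eq_zero_iff.1 (hord p)
  · rw [toMeromorphicNFOn_eq_toMeromorphicNFAt hmo (Set.mem_univ p),
      toMeromorphicNFAt_eq_self.2 hp.meromorphicNFAt]

/-- Selects one representative of each pair ±p, since a Blaschke factor in z² accounts for both. -/
theorem exists_fin_enumeration_of_sq {Z : Set ℂ} (hZ : Z.Finite) :
    ∃ (N : ℕ) (α : Fin N → ℂ), (∀ j, α j ∈ Z) ∧ Function.Injective (fun j => α j ^ 2) ∧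
      ∀ p ∈ Z, ∃ j, p ^ 2 = α j ^ 2 := by
  have hW := hZ.image (· ^ 2)
  set e := hW.toFinset.equivFin with he
  have hmem : ∀ j, ∃ p ∈ Z, p ^ 2 = (e.symm j : ℂ) := fun j => by
    simpa using (hW.mem_toFinset.1 (e.symm j).2)
  choose α hα hα2 using hmem
  refine ⟨_, α, hα, fun i j hij => ?_, fun p hp => ?_⟩
  · simp only [hα2] at hij
    exact e.symm.injective (Subtype.ext hij)
  · refine ⟨e ⟨p ^ 2, hW.mem_toFinset.2 ⟨p, hp, rfl⟩⟩, ?_⟩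
    rw [hα2, Equiv.symm_apply_apply]

/-- Boundary modulus of a Blaschke product. -/
theorem norm_prod_sub_sq_eq {N : ℕ} (α : Fin N → ℂ) {z : ℂ} (hz : ‖z‖ = 1) :
    ‖∏ j, (1 - conj (α j) ^ 2 * z ^ 2)‖ = ‖∏ j, (α j ^ 2 - 1 * z ^ 2)‖ := by
  rw [norm_prod, norm_prod]
  refine Finset.prod_congr rfl fun j _ => ?_
  have hzz : z * conj z = 1 := by
    rw [Complex.mul_conj, Complex.normSq_eq_norm_sq, hz]; simp
  have : 1 - conj (α j) ^ 2 * z ^ 2 = -z ^ 2 * conj (α j ^ 2 - 1 * z ^ 2) := by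
    simp only [map_sub, map_pow, one_mul]
    linear_combination (-1 - z * conj z) * hzz
  rw [this, norm_mul, RCLike.norm_conj, norm_neg, norm_pow, hz, one_pow, one_mul]

theorem analyticOrderAt_add_eq_two {b g S : ℂ → ℂ} (h : ∀ z, z ≠ 0 → b z * g z = S z ^ 2) {p : ℂ}
    (hp : p ≠ 0) (hb : AnalyticAt ℂ b p) (hg : AnalyticAt ℂ g p) (hS : AnalyticAt ℂ S p)
    (h1 : analyticOrderAt S p = 1) : analyticOrderAt b p + analyticOrderAt g p = 2 := by
  rw [← analyticOrderAt_mul hb hg, analyticOrderAt_congr (g := S ^ 2), analyticOrderAt_pow hS, h1]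
  · rfl
  · filter_upwards [isOpen_compl_singleton.mem_nhds hp] with z hz using h z hz

/-- A² continues to the whole plane as b/S. Its zeros outside U form the set Z of zeros of S at
which g does not vanish, its poles are the reflections of Z, and all are simple. Multiplying by Q/P
removes them all. -/
theorem exists_blaschke_of_extension {q : ℂ} (hq : q ≠ 0) {r : ℝ} (hr : 0 < r)
    (hr1 : r ≤ 1) {a b g A : ℂ → ℂ} {U : Set ℂ} (hU : IsOpen U) (hball : Metric.ball 0 r ⊆ U)
    (hcirc : Metric.sphere 0 1 ⊆ U) (hA : DifferentiableOn ℂ A U) (hA0 : ∀ z ∈ U, A z ≠ 0)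
    (hA1 : ∀ z ∈ Metric.sphere (0 : ℂ) 1, ‖A z‖ = 1)
    (hAb : ∀ z ∈ U, z ≠ 0 → A z ^ 2 * cylSinh q z = b z)
    (hAg : ∀ z ∈ U, z ≠ 0 → A z ^ 2 * g z = cylSinh q z)
    (hb : DifferentiableOn ℂ b {0}ᶜ) (hg : DifferentiableOn ℂ g {0}ᶜ)
    (hbg : ∀ z, z ≠ 0 → b z * g z = cylSinh q z ^ 2) (hodd : ∀ z, z ≠ 0 → g (-z) = -g z)
    (hstar : ∀ z, z ≠ 0 → conj (b (1 / conj z)) = -g z)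
    (hsph : ∀ z ∈ Metric.sphere (0 : ℂ) r,
      b z = a z ^ 2 * cylSinh q z ∧ g z = (a z ^ 2)⁻¹ * cylSinh q z)
    (hlim : ∀ z ∈ Metric.sphere (0 : ℂ) r, Tendsto A (𝓝[Metric.ball 0 r] z) (𝓝 (a z))) :
    ∃ (N : ℕ) (α : Fin N → ℂ) (c : ℂ), ‖c‖ = 1 ∧ (∀ j, α j ∈ spectralSet r q) ∧
      Function.Injective (fun j => α j ^ 2) ∧
      ∀ l ∈ Metric.sphere (0 : ℂ) r,
        a l ^ 2 = c * ∏ j, (α j ^ 2 - l ^ 2) / (1 - conj (α j) ^ 2 * l ^ 2) := by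
  classical
  set S := cylSinh q with hSdef
  set Z : Set ℂ := {z | z ≠ 0 ∧ S z = 0 ∧ g z ≠ 0} with hZdef
  have hZU : ∀ z ∈ Z, z ∉ U := by
    rintro z ⟨hz0, hSz, hgz⟩ hzU
    have := hAg z hzU hz0
    rw [hSz] at this
    exact (mul_ne_zero (pow_ne_zero 2 (hA0 z hzU)) hgz) this
  have hbU : ∀ z, z ≠ 0 → S z = 0 → b z ≠ 0 → z ∉ U := by
    intro z hz0 hSz hbz hzU
    have := hAb z hzU hz0
    rw [hSz, mul_zero] at this
    exact hbz this.symm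
  have hrefl : ∀ z, z ≠ 0 → S z = 0 → (b z ≠ 0 ↔ 1 / conj z ∈ Z) := by
    intro z hz0 hSz
    have hw0 : 1 / conj z ≠ 0 := by simpa using hz0
    have hS' : S (1 / conj z) = 0 := by rw [hSdef, cylSinh_one_div_conj, ← hSdef, hSz]; simp
    have hb' := hstar (1 / conj z) hw0
    have hww : 1 / conj (1 / conj z) = z := by simp
    rw [hww] at hb'
    have : g (1 / conj z) = -conj (b z) := by rw [hb', neg_neg]
    refine ⟨fun h => ⟨hw0, hS', ?_⟩, fun h h0 => h.2.2 ?_⟩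
    · rw [this]; simpa using h
    · rw [this, h0]; simp
  have hout : ∀ z, z ∉ U → z ∉ Metric.sphere (0 : ℂ) r → r < ‖z‖ := by
    intro z hzU hzs
    by_contra hcon
    rcases (not_lt.1 hcon).lt_or_eq with h | h
    · exact hzU (hball (by simpa using h))
    · exact hzs (by simpa using h)
  -- Z avoids the disc because A is zero free on U, and avoids C_r because b and g are there
  -- multiples of S. The reflected point is a zero of S with b ≠ 0, so the same argument gives the
  -- outer bound.
  have hZann : ∀ z ∈ Z, z ∈ annulus r := by
    intro z hz
    obtain ⟨hz0, hSz, hgz⟩ := id hz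
    refine ⟨hout z (hZU z hz) fun hs => hgz ?_, ?_⟩
    · rw [(hsph z hs).2]
      exact mul_eq_zero_of_right _ hSz
    · have hw0 : 1 / conj z ≠ 0 := by simpa using hz0
      have hS' : S (1 / conj z) = 0 := by rw [hSdef, cylSinh_one_div_conj, ← hSdef, hSz]; simp
      have hww : 1 / conj (1 / conj z) = z := by simp
      have hbw : b (1 / conj z) ≠ 0 := (hrefl _ hw0 hS').2 (hww.symm ▸ hz)
      have hlt := hout _ (hbU _ hw0 hS' hbw) fun hs => hbw (by
        rw [(hsph _ hs).1]; exact mul_eq_zero_of_right _ hS')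
      rw [norm_div, norm_one, RCLike.norm_conj] at hlt
      exact (lt_one_div hr (norm_pos_iff.2 hz0)).1 hlt
  have hZfin : Z.Finite := (finite_cylSinh_zeros hq hr).subset fun z hz =>
    ⟨⟨(hZann z hz).1.le, (hZann z hz).2.le⟩, hz.2.1⟩
  have hZneg : ∀ z ∈ Z, -z ∈ Z := by
    rintro z ⟨hz0, hSz, hgz⟩
    refine ⟨neg_ne_zero.2 hz0, ?_, ?_⟩
    · rw [hSdef, cylSinh_neg, ← hSdef, hSz, neg_zero]
    · rw [hodd z hz0]; exact neg_ne_zero.2 hgz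
  obtain ⟨N, α, hαZ, hαinj, hαsurj⟩ := exists_fin_enumeration_of_sq hZfin
  have hα0 : ∀ j, α j ≠ 0 := fun j => (hαZ j).1
  have hmemZ : ∀ z j, z ^ 2 = α j ^ 2 → z ∈ Z := by
    intro z j h
    rcases sq_eq_sq_iff_eq_or_eq_neg.1 h with h | h
    · exact h ▸ hαZ j
    · exact h ▸ hZneg _ (hαZ j)
  -- The coefficient 1 puts P and Q in the common form u - v z² of `analyticOrderAt_prod_sub_sq`.
  set P : ℂ → ℂ := fun z => ∏ j, (α j ^ 2 - 1 * z ^ 2) with hP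
  set Q : ℂ → ℂ := fun z => ∏ j, (1 - conj (α j) ^ 2 * z ^ 2) with hQ
  have hPd : Differentiable ℂ P := Differentiable.fun_finsetProd fun j _ => by fun_prop
  have hQd : Differentiable ℂ Q := Differentiable.fun_finsetProd fun j _ => by fun_prop
  have hP0 : ∀ z, z ∉ Z → P z ≠ 0 := by
    intro z hz
    refine Finset.prod_ne_zero_iff.2 fun j _ h => hz (hmemZ z j ?_)
    linear_combination -h
  have hQ0 : ∀ z, 1 / conj z ∉ Z → Q z ≠ 0 := by
    intro z hz
    refine Finset.prod_ne_zero_iff.2 fun j _ h => hz (hmemZ _ j ?_)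
    have h1 := congrArg conj h
    simp only [map_sub, map_one, map_mul, map_pow, Complex.conj_conj, map_zero] at h1
    have hz0 : conj z ≠ 0 := by
      intro h0; rw [h0] at h1; norm_num at h1
    field_simp
    linear_combination h1
  have hPord : ∀ z ∈ Z, analyticOrderAt P z = 1 := by
    intro z hz
    obtain ⟨j, hj⟩ := hαsurj z hz
    refine analyticOrderAt_prod_sub_sq _ (fun _ => 1) hz.1 j one_ne_zero (by rw [hj, one_mul])
      fun i hi h => hi (hαinj ?_)
    simp only [one_mul] at h
    exact h.trans hj
  have hQord : ∀ z, 1 / conj z ∈ Z → analyticOrderAt Q z = 1 := by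
    intro z hz
    obtain ⟨j, hj⟩ := hαsurj _ hz
    have hz0 : z ≠ 0 := by rintro rfl; exact hz.1 (by simp)
    have hcz : conj z ≠ 0 := by simpa using hz0
    have hj' : (1 : ℂ) = conj (α j) ^ 2 * z ^ 2 := by
      have := congrArg conj hj
      simp only [map_pow, map_div₀, map_one, Complex.conj_conj] at this
      rw [← this]; field_simp
    refine analyticOrderAt_prod_sub_sq (fun _ => 1) _ hz0 j (pow_ne_zero 2 (by simpa using hα0 j))
      hj' fun i hi h => hi (hαinj ?_)
    have h2 := mul_right_cancel₀ (pow_ne_zero 2 hz0) (h.symm.trans hj')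
    have := congrArg conj h2
    simpa using this
  have hUP : ∀ z ∈ U, P z ≠ 0 := fun z hz => hP0 z fun h => hZU z h hz
  have hUQ : ∀ z ∈ U, Q z ≠ 0 := by
    intro z hz
    refine hQ0 z fun h => ?_
    have hz0 : z ≠ 0 := by rintro rfl; exact h.1 (by simp)
    have hSz : S z = 0 := by
      have h1 := h.2.1
      rw [hSdef, cylSinh_one_div_conj, neg_eq_zero] at h1
      simpa using h1
    exact hbU z hz0 hSz ((hrefl z hz0 hSz).2 h) hz
  set K₁ : ℂ → ℂ := fun z => (b z * Q z) / (S z * P z) with hK₁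
  -- The formula with A is indispensable at 0 and on the unit circle, both inside U; elsewhere b/S
  -- replaces A². Near any p ≠ 0 the two agree off isolated points.
  set K₀ : ℂ → ℂ := fun z => if z ∈ U then A z ^ 2 * Q z / P z else K₁ z with hK₀
  have hK₀U : ∀ z ∈ U, K₀ z = A z ^ 2 * Q z / P z := fun z hz => if_pos hz
  have hK₀an : ∀ z ∈ U, AnalyticAt ℂ K₀ z := by
    intro z hz
    have hev : K₀ =ᶠ[𝓝 z] fun z => A z ^ 2 * Q z / P z :=
      Filter.eventuallyEq_of_mem (hU.mem_nhds hz) hK₀U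
    have hAan := hA.analyticAt (hU.mem_nhds hz)
    exact (((hAan.pow 2).mul (hQd.analyticAt z)).div (hPd.analyticAt z) (hUP z hz)).congr hev.symm
  have hK₀ne : ∀ z ∈ U, K₀ z ≠ 0 := by
    intro z hz
    rw [hK₀U z hz]
    exact div_ne_zero (mul_ne_zero (pow_ne_zero 2 (hA0 z hz)) (hUQ z hz)) (hUP z hz)
  have hK₀₁ : ∀ p, p ≠ 0 → K₀ =ᶠ[𝓝[≠] p] K₁ := by
    intro p hp
    filter_upwards [eventually_cylSinh_ne_zero hq hp,
      mem_nhdsWithin_of_mem_nhds (isOpen_compl_singleton.mem_nhds hp)] with z hSz hz0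
    by_cases hz : z ∈ U
    · rw [hK₀U z hz, hK₁]
      simp only
      rw [← hAb z hz hz0, ← mul_div_mul_left _ _ hSz, hSdef]
      ring
    · exact if_neg hz
  have hSan : ∀ p, p ≠ 0 → AnalyticAt ℂ S p := fun p hp => analyticOnNhd_cylSinh q p hp
  have hban : ∀ p, p ≠ 0 → AnalyticAt ℂ b p := fun p hp =>
    hb.analyticAt (isOpen_compl_singleton.mem_nhds hp)
  have hgan : ∀ p, p ≠ 0 → AnalyticAt ℂ g p := fun p hp =>
    hg.analyticAt (isOpen_compl_singleton.mem_nhds hp)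
  have hmer : ∀ p, MeromorphicAt K₀ p := by
    intro p
    by_cases hpU : p ∈ U
    · exact (hK₀an p hpU).meromorphicAt
    · have hp0 : p ≠ 0 := by rintro rfl; exact hpU (hball (by simpa using hr))
      exact (((hban p hp0).meromorphicAt.mul (hQd.analyticAt p).meromorphicAt).div
        ((hSan p hp0).meromorphicAt.mul (hPd.analyticAt p).meromorphicAt)).congr (hK₀₁ p hp0).symm
  have hord : ∀ p, meromorphicOrderAt K₀ p = 0 := by
    intro p
    by_cases hpU : p ∈ U
    · rw [(hK₀an p hpU).meromorphicOrderAt_eq,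
        (hK₀an p hpU).analyticOrderAt_eq_zero.2 (hK₀ne p hpU)]
      rfl
    have hp0 : p ≠ 0 := by rintro rfl; exact hpU (hball (by simpa using hr))
    have hp1 : ‖p‖ ≠ 1 := fun h => hpU (hcirc (by simpa using h))
    have hbp := hban p hp0
    have hgp := hgan p hp0
    have hSp := hSan p hp0
    have hPp := hPd.analyticAt p
    have hQp := hQd.analyticAt p
    -- At a simple zero of S the orders of b and g add up to 2. The cases (0,2), (1,1), (2,0) are
    -- balanced by a simple zero of Q, by none, and by a simple zero of P.
    have hsum : analyticOrderAt b p + analyticOrderAt Q p =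
        analyticOrderAt S p + analyticOrderAt P p ∧
        analyticOrderAt S p + analyticOrderAt P p ≠ ⊤ := by
      by_cases hS0 : S p = 0
      · have hS1 : analyticOrderAt S p = 1 :=
          hSp.analyticOrderAt_eq_one_of_zero_deriv_ne_zero hS0
            (deriv_cylSinh_ne_zero hq hp0 hp1 hS0)
        have h2 := analyticOrderAt_add_eq_two hbg hp0 hbp hgp hSp hS1
        by_cases hgp0 : g p = 0
        · have hPne := hPp.analyticOrderAt_eq_zero.2 (hP0 p fun h => h.2.2 hgp0)
          by_cases hbp0 : b p = 0
          · have hQne := hQp.analyticOrderAt_eq_zero.2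
              (hQ0 p fun h => (hrefl p hp0 hS0).2 h hbp0)
            have hb1 := hbp.analyticOrderAt_ne_zero.2 hbp0
            have hg1 := hgp.analyticOrderAt_ne_zero.2 hgp0
            have : analyticOrderAt b p = 1 := by
              generalize analyticOrderAt b p = x at *
              generalize analyticOrderAt g p = y at *
              induction x using ENat.recTopCoe with
              | top => simp at h2
              | coe x =>
                induction y using ENat.recTopCoe with
                | top => simp at h2
                | coe y => norm_cast at *; omega
            rw [this, hQne, hS1, hPne]
            simp
          · rw [hbp.analyticOrderAt_eq_zero.2 hbp0, hQord p ((hrefl p hp0 hS0).1 hbp0), hS1, hPne]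
            simp
        · have hpZ : p ∈ Z := ⟨hp0, hS0, hgp0⟩
          rw [hgp.analyticOrderAt_eq_zero.2 hgp0, add_zero] at h2
          have hb0 : b p = 0 := by
            have := hbg p hp0
            rw [hS0] at this
            simpa [hgp0] using this
          rw [h2, hS1, hPord p hpZ,
            hQp.analyticOrderAt_eq_zero.2 (hQ0 p fun h => (hrefl p hp0 hS0).2 h hb0)]
          exact ⟨rfl, by simp⟩
      · have hbg0 : b p * g p ≠ 0 := by rw [hbg p hp0]; exact pow_ne_zero 2 hS0
        have hS' : 1 / conj p ∉ Z := fun h => hS0 (by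
          have h1 := h.2.1
          rw [hSdef, cylSinh_one_div_conj, neg_eq_zero] at h1
          simpa using h1)
        rw [hbp.analyticOrderAt_eq_zero.2 (left_ne_zero_of_mul hbg0),
          hSp.analyticOrderAt_eq_zero.2 hS0, hPp.analyticOrderAt_eq_zero.2 (hP0 p fun h => hS0 h.2.1),
          hQp.analyticOrderAt_eq_zero.2 (hQ0 p hS')]
        simp
    rw [meromorphicOrderAt_congr (hK₀₁ p hp0), hK₁,
      fun_meromorphicOrderAt_div (hbp.fun_mul hQp).meromorphicAt (hSp.fun_mul hPp).meromorphicAt,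
      (hbp.fun_mul hQp).meromorphicOrderAt_eq, (hSp.fun_mul hPp).meromorphicOrderAt_eq]
    have e1 : analyticOrderAt (fun z => b z * Q z) p = _ := analyticOrderAt_mul hbp hQp
    have e2 : analyticOrderAt (fun z => S z * P z) p = _ := analyticOrderAt_mul hSp hPp
    rw [e1, e2, hsum.1]
    obtain ⟨m, hm⟩ := ENat.ne_top_iff_exists.1 hsum.2
    rw [← hm]
    simp
  obtain ⟨K, hKd, hKne, hKeq⟩ := exists_entire_of_meromorphicOrderAt_eq_zero hmer hord
  have hKU : ∀ z ∈ U, K z = A z ^ 2 * Q z / P z := fun z hz =>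
    (hKeq z (hK₀an z hz)).trans (hK₀U z hz)
  obtain ⟨c, hc, hKc⟩ := exists_eqOn_const_of_norm_eq_one hKd.diffContOnCl (fun z _ => hKne z)
    (fun z hz => by
      have hz1 : ‖z‖ = 1 := by simpa using hz
      have h0 := norm_ne_zero_iff.2 (hUP z (hcirc hz))
      rw [hKU z (hcirc hz), norm_div, norm_mul, norm_pow, hA1 z hz, one_pow, one_mul,
        norm_prod_sub_sq_eq α hz1, div_self h0])
  refine ⟨N, α, c, hc, fun j => mem_spectralSet_iff.2 ⟨hZann _ (hαZ j), (hαZ j).2.1⟩, hαinj, ?_⟩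
  intro l hl
  -- The loop a is known only as a boundary value, so the identity is proved in I_r and passes to
  -- C_r in the limit.
  have hPQ : ∀ z ∈ Metric.ball (0 : ℂ) r, A z ^ 2 * Q z = c * P z := by
    intro z hz
    have hzU := hball hz
    have h1 := hKc z (Metric.ball_subset_closedBall (Metric.ball_subset_ball hr1 hz))
    rwa [hKU z hzU, div_eq_iff (hUP z hzU)] at h1
  have hne : NeBot (𝓝[Metric.ball (0 : ℂ) r] l) := by
    rw [← mem_closure_iff_nhdsWithin_neBot, closure_ball _ hr.ne']
    exact Metric.sphere_subset_closedBall hl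
  have h1 : Tendsto (fun z => A z ^ 2 * Q z) (𝓝[Metric.ball (0 : ℂ) r] l) (𝓝 (a l ^ 2 * Q l)) :=
    ((hlim l hl).pow 2).mul ((hQd.continuous.tendsto l).mono_left nhdsWithin_le_nhds)
  have h2 : Tendsto (fun z => c * P z) (𝓝[Metric.ball (0 : ℂ) r] l) (𝓝 (c * P l)) :=
    ((hPd.continuous.tendsto l).mono_left nhdsWithin_le_nhds).const_mul c
  have h3 := tendsto_nhds_unique
    (h1.congr' (Filter.eventuallyEq_of_mem self_mem_nhdsWithin hPQ)) h2
  have hQl : Q l ≠ 0 := by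
    have hl' : ‖l‖ = r := by simpa using hl
    refine hQ0 l fun h => ?_
    have := (hZann _ h).2
    rw [norm_div, norm_one, RCLike.norm_conj, hl'] at this
    exact lt_irrefl _ this
  rw [Finset.prod_div_distrib, mul_div_assoc', eq_div_iff hQl, h3, hP]
  simp

/-- Holomorphic identities on the disc propagate to a domain that contains it, even when one of
the functions has a singularity at the centre. -/
theorem eqOn_of_eqOn_punctured_ball {f h : ℂ → ℂ} {U : Set ℂ} {r : ℝ} (hr : 0 < r)
    (hU : IsOpen U) (hconn : IsPreconnected U) (hball : Metric.ball 0 r ⊆ U)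
    (hf : DifferentiableOn ℂ f (U \ {0})) (hh : DifferentiableOn ℂ h (U \ {0}))
    (heq : ∀ z ∈ Metric.ball (0 : ℂ) r \ {0}, f z = h z) :
    ∀ z ∈ U, z ≠ 0 → f z = h z := by
  classical
  -- The difference vanishes on the punctured disc, so 0 is a removable singularity of f - h even if
  -- it is essential for f or h.
  set E : ℂ → ℂ := fun z => if z = 0 then 0 else f z - h z with hE
  have hEball : ∀ z ∈ Metric.ball (0 : ℂ) r, E z = 0 := by
    intro z hz
    by_cases h0 : z = 0
    · exact if_pos h0
    · rw [hE]; simp only [if_neg h0]; rw [heq z ⟨hz, h0⟩, sub_self]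
  have h0U : (0 : ℂ) ∈ Metric.ball (0 : ℂ) r := Metric.mem_ball_self hr
  have hev : E =ᶠ[𝓝 0] 0 := Filter.eventuallyEq_of_mem (Metric.isOpen_ball.mem_nhds h0U) hEball
  have hd : DifferentiableOn ℂ E U := by
    intro z hz
    by_cases h0 : z = 0
    · rw [h0]
      exact (hev.differentiableAt_iff.2 (differentiableAt_const 0)).differentiableWithinAt
    · have hz' : U \ {0} ∈ 𝓝 z := (hU.sdiff isClosed_singleton).mem_nhds ⟨hz, h0⟩
      have : E =ᶠ[𝓝 z] fun z => f z - h z :=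
        Filter.eventuallyEq_of_mem hz' fun w hw => if_neg hw.2
      exact (this.differentiableAt_iff.2
        ((hf.differentiableAt hz').sub (hh.differentiableAt hz'))).differentiableWithinAt
  intro z hz h0
  have := (hd.analyticOnNhd hU).eqOn_zero_of_preconnected_of_eventuallyEq_zero hconn
    (hball h0U) hev hz
  rw [hE] at this
  simpa [h0, sub_eq_zero] using this

/-- For r < 1 every relation between a, b, g and S on C_r spreads first to I_r by boundary
uniqueness, then to U by connectedness. Since r' < 1, U contains the unit circle, where the star
condition says that the diagonal entry A has modulus 1. -/
theorem exists_blaschke_of_dressing {n : ℕ∞} {r : ℝ} (hr0 : 0 < r) (hr1 : r ≤ 1) {q : ℂ}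
    (hq : q ≠ 0) {a : ℂ → ℂ} (ha : diagLoop a ∈ LambdaPlus n r)
    (hext : ExtendsUnitarily r (diagLoop a))
    (h : (fun l => diagLoop a l * cylinderMonodromy q l * (diagLoop a l)⁻¹) ∈
      LambdaPuncturedSU r) :
    ∃ (N : ℕ) (α : Fin N → ℂ) (c : ℂ), ‖c‖ = 1 ∧ (∀ j, α j ∈ spectralSet r q) ∧
      Function.Injective (fun j => α j ^ 2) ∧
      ∀ l ∈ Metric.sphere (0 : ℂ) r,
        a l ^ 2 = c * ∏ j, (α j ^ 2 - l ^ 2) / (1 - conj (α j) ^ 2 * l ^ 2) := by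
  rcases hr1.lt_or_eq with hr | rfl
  swap
  · obtain ⟨c, hc, hac⟩ := const_of_boundary_unitary hq ha h
    exact ⟨0, ![], c, hc, fun j => j.elim0, fun j => j.elim0, fun l hl => by simp [hac l hl]⟩
  have hne : ∀ z ∈ Metric.sphere (0 : ℂ) r, a z ≠ 0 := fun z hz =>
    ne_zero_of_isTwistedLoop_diagLoop ha.1 hz
  obtain ⟨b, g, hb, hg, hbg, hodd, hstar, hsph⟩ := exists_offDiagonal_of_mem hr0 hne h
  obtain ⟨r', ⟨hrr', -⟩, hr', U, G, hU, hUc, hball, hann, hGU, ⟨hGb, hGlim⟩, hGstar⟩ := hext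
  replace hr' := hr' hr
  have hcirc : Metric.sphere (0 : ℂ) 1 ⊆ annulus r' := by
    intro z hz
    have hz1 : ‖z‖ = 1 := by simpa using hz
    exact ⟨by rwa [hz1], by rw [hz1]; exact one_lt_one_div (hr0.trans_le hrr') hr'⟩
  have hlim : ∀ i j, ∀ z ∈ Metric.sphere (0 : ℂ) r,
      Tendsto (fun w => G w i j) (𝓝[Metric.ball 0 r] z) (𝓝 (diagLoop a z i j)) :=
    fun i j z hz => tendsto_apply (hGlim z hz) i j
  have hoff : ∀ i j, i ≠ j → ∀ z ∈ U, z ≠ 0 → G z i j = 0 := by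
    intro i j hij
    refine eqOn_of_eqOn_punctured_ball (h := fun _ => 0) hr0 hU hUc.isPreconnected hball
      ((hGU i j).mono Set.sdiff_subset) (differentiableOn_const 0) ?_
    refine eqOn_zero_of_tendsto_zero_sphere ((hGb i j).mono Set.sdiff_subset) fun z hz => ?_
    have := hlim i j z hz
    have h0 : diagLoop a z i j = 0 := by
      fin_cases i <;> fin_cases j <;> simp [diagLoop] at hij ⊢
    rwa [h0] at this
  have hAB : ∀ z ∈ U, z ≠ 0 → G z 0 0 * G z 1 1 = 1 := by
    refine eqOn_of_eqOn_punctured_ball (h := fun _ => 1) hr0 hU hUc.isPreconnected hball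
      (((hGU 0 0).mul (hGU 1 1)).mono Set.sdiff_subset) (differentiableOn_const 1) fun z hz => ?_
    refine sub_eq_zero.1 (eqOn_zero_of_tendsto_zero_sphere (D := fun z => G z 0 0 * G z 1 1 - 1)
      ((((hGb 0 0).mul (hGb 1 1)).sub_const 1).mono Set.sdiff_subset) (fun w hw => ?_) z hz)
    have := ((hlim 0 0 w hw).mul (hlim 1 1 w hw)).sub_const 1
    simpa [diagLoop, hne w hw] using this
  have hAB0 : G 0 0 0 * G 0 1 1 = 1 := by
    have h0 : (0 : ℂ) ∈ U := hball (Metric.mem_ball_self hr0)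
    refine eqOn_ball_of_eqOn_punctured_ball (g := fun z => G z 0 0 * G z 1 1) (h := fun _ => 1) hr0
      (((hGU 0 0).mul (hGU 1 1)).differentiableAt (hU.mem_nhds h0)).continuousAt
      continuousAt_const (fun z hz => hAB z (hball hz.1) hz.2) 0 (Metric.mem_ball_self hr0)
  have hA0 : ∀ z ∈ U, G z 0 0 ≠ 0 := by
    intro z hz
    rcases eq_or_ne z 0 with rfl | h0
    exacts [left_ne_zero_of_mul_eq_one hAB0, left_ne_zero_of_mul_eq_one (hAB z hz h0)]
  have hS0 : Metric.ball (0 : ℂ) r \ {0} ⊆ {0}ᶜ := fun z hz => hz.2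
  have hU0 : U \ {0} ⊆ {0}ᶜ := fun z hz => hz.2
  have hnear : ∀ {f : ℂ → ℂ}, DifferentiableOn ℂ f {0}ᶜ → ∀ z ∈ Metric.sphere (0 : ℂ) r,
      Tendsto f (𝓝[Metric.ball 0 r] z) (𝓝 (f z)) := by
    intro f hf z hz
    have hz0 : z ≠ 0 := by rintro rfl; simp at hz; exact hr0.ne hz
    exact (hf.differentiableAt (isOpen_compl_singleton.mem_nhds hz0)).continuousAt.tendsto.mono_left
      nhdsWithin_le_nhds
  have hS := differentiableOn_cylSinh q
  refine exists_blaschke_of_extension hq hr0 hr1 hU hball (hcirc.trans hann) (hGU 0 0) hA0 ?_ ?_ ?_ hb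
    hg hbg hodd hstar hsph (fun z hz => by simpa [diagLoop] using hlim 0 0 z hz)
  · intro z hz
    have hz1 : ‖z‖ = 1 := by simpa using hz
    have hz0 : z ≠ 0 := norm_pos_iff.1 (by rw [hz1]; norm_num)
    have hzU := hann (hcirc hz)
    have hGz : (G z)⁻¹ = !![G z 1 1, 0; 0, G z 0 0] := by
      apply Matrix.inv_eq_right_inv
      have h01 := hoff 0 1 (by decide) z hzU hz0
      have h10 := hoff 1 0 (by decide) z hzU hz0
      have h1 := hAB z hzU hz0
      ext i j
      fin_cases i <;> fin_cases j <;>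
        simp [Matrix.mul_apply, Fin.sum_univ_two, h01, h10, h1, mul_comm (G z 1 1)]
    have h2 := congrFun (congrFun (hGstar z (hcirc hz)) 0) 0
    rw [hGz, loopStar, conj_one_div_conj_eq hz1] at h2
    simp only [Matrix.conjTranspose_apply, Matrix.of_apply, Matrix.cons_val_zero] at h2
    have h3 := hAB z hzU hz0
    rw [← h2, ← starRingEnd_apply, Complex.mul_conj, Complex.normSq_eq_norm_sq] at h3
    exact (pow_eq_one_iff_of_nonneg (norm_nonneg _) two_ne_zero).1 (by exact_mod_cast h3)
  · refine eqOn_of_eqOn_punctured_ball hr0 hU hUc.isPreconnected hball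
      ((((hGU 0 0).mono Set.sdiff_subset).fun_pow 2).fun_mul (hS.mono hU0)) (hb.mono hU0)
      fun z hz => ?_
    refine sub_eq_zero.1 (eqOn_zero_of_tendsto_zero_sphere
      (D := fun z => G z 0 0 ^ 2 * cylSinh q z - b z)
      ((((((hGb 0 0).mono Set.sdiff_subset).fun_pow 2).fun_mul (hS.mono hS0))).fun_sub
        (hb.mono hS0)) (fun w hw => ?_) z hz)
    have := (((hlim 0 0 w hw).pow 2).mul (hnear hS w hw)).sub (hnear hb w hw)
    simpa [diagLoop, (hsph w hw).1] using this
  · refine eqOn_of_eqOn_punctured_ball hr0 hU hUc.isPreconnected hball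
      ((((hGU 0 0).mono Set.sdiff_subset).fun_pow 2).fun_mul (hg.mono hU0)) (hS.mono hU0)
      fun z hz => ?_
    refine sub_eq_zero.1 (eqOn_zero_of_tendsto_zero_sphere
      (D := fun z => G z 0 0 ^ 2 * g z - cylSinh q z)
      ((((((hGb 0 0).mono Set.sdiff_subset).fun_pow 2).fun_mul (hg.mono hS0))).fun_sub
        (hS.mono hS0)) (fun w hw => ?_) z hz)
    have := (((hlim 0 0 w hw).pow 2).mul (hnear hg w hw)).sub (hnear hS w hw)
    simpa [diagLoop, (hsph w hw).2, hne w hw] using this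

/-! ### From a Blaschke product back to a holomorphic dressed monodromy. -/

theorem exists_eq_prod_sub_mul {ι : Type*} (T : Finset ι) {p : ι → ℂ} (hp : ∀ i ∈ T, p i ≠ 0)
    (hinj : Set.InjOn p T) {g : ℂ → ℂ} (hg : DifferentiableOn ℂ g {0}ᶜ)
    (h0 : ∀ i ∈ T, g (p i) = 0) :
    ∃ h : ℂ → ℂ, DifferentiableOn ℂ h {0}ᶜ ∧ ∀ z, g z = (∏ i ∈ T, (z - p i)) * h z := by
  classical
  induction T using Finset.induction_on with
  | empty => exact ⟨g, hg, fun z => by simp⟩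
  | insert i T hi ih =>
    obtain ⟨h, hh, heq⟩ := ih (fun j hj => hp j (Finset.mem_insert_of_mem hj))
      (hinj.mono (by simp)) (fun j hj => h0 j (Finset.mem_insert_of_mem hj))
    have hiT := Finset.mem_insert_self i T
    have hhi : h (p i) = 0 := by
      have h1 := heq (p i)
      rw [h0 i hiT] at h1
      refine (mul_eq_zero.1 h1.symm).resolve_left (Finset.prod_ne_zero_iff.2 fun j hj h2 => ?_)
      have : i = j := hinj (by simp) (by simp [hj]) (sub_eq_zero.1 h2)
      exact hi (this ▸ hj)
    refine ⟨dslope h (p i), (Complex.differentiableOn_dslope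
      (isOpen_compl_singleton.mem_nhds (hp i hiT))).2 hh, fun z => ?_⟩
    have h1 := sub_smul_dslope h (p i) z
    rw [hhi, sub_zero, smul_eq_mul] at h1
    rw [heq, Finset.prod_insert hi, ← h1]
    ring

/-- S is odd, so it vanishes at all of ±p j. These 2N points are distinct because the squares are
distinct and nonzero, and each can be divided out. -/
theorem exists_cylSinh_eq_prod_mul {q : ℂ} {N : ℕ} (u v p : Fin N → ℂ) (hv : ∀ j, v j ≠ 0)
    (hp : ∀ j, p j ≠ 0) (hu : ∀ j, u j = v j * p j ^ 2)
    (hinj : Function.Injective fun j => p j ^ 2) (h0 : ∀ j, cylSinh q (p j) = 0) :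
    ∃ h : ℂ → ℂ, DifferentiableOn ℂ h {0}ᶜ ∧
      ∀ z, cylSinh q z = (∏ j, (u j - v j * z ^ 2)) * h z := by
  obtain ⟨h, hh, heq⟩ := exists_eq_prod_sub_mul (Finset.univ : Finset (Fin N ⊕ Fin N))
    (p := Sum.elim p (-p)) (g := cylSinh q) (by rintro (i | i) - <;> simp [hp])
    (by
      have hne : ∀ i j, p i ≠ -p j := fun i j h => by
        have hij : i = j := hinj (by simp only [h, neg_sq])
        subst hij
        exact hp i (self_eq_neg.1 h)
      have hi : Function.Injective p := fun i j h => hinj (by simp only [h])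
      rintro (i | i) - (j | j) - h
      · exact congrArg _ (hi h)
      · exact absurd h (hne i j)
      · exact absurd h.symm (hne j i)
      · exact congrArg _ (hi (neg_injective h)))
    (differentiableOn_cylSinh q) (by rintro (i | i) - <;> simp [h0])
  refine ⟨fun z => (∏ j, (-v j))⁻¹ * h z, hh.const_mul _, fun z => ?_⟩
  have hv' : ∏ j, (-v j) ≠ 0 := Finset.prod_ne_zero_iff.2 fun j _ => neg_ne_zero.2 (hv j)
  have hfac : ∏ j, (u j - v j * z ^ 2) = (∏ j, (-v j)) * ((∏ j, (z - p j)) * ∏ j, (z + p j)) := by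
    rw [← Finset.prod_mul_distrib, ← Finset.prod_mul_distrib]
    refine Finset.prod_congr rfl fun j _ => ?_
    rw [hu]; ring
  rw [heq, Fintype.prod_sum_type, hfac]
  simp only [Sum.elim_inl, Sum.elim_inr, Pi.neg_apply, sub_neg_eq_add]
  field_simp

/-- Holomorphic functions on a connected open set have no zero divisors. This allows P or Q to be
cancelled even at its zeros. -/
theorem eq_zero_of_mul_eq_zero_on_compl_zero {u w : ℂ → ℂ} (hu : DifferentiableOn ℂ u {0}ᶜ)
    (hw : DifferentiableOn ℂ w {0}ᶜ) (h : ∀ z, z ≠ 0 → w z * u z = 0) {z₁ : ℂ} (hz₁ : z₁ ≠ 0)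
    (hw₁ : w z₁ ≠ 0) {z : ℂ} (hz : z ≠ 0) : u z = 0 := by
  rcases AnalyticOnNhd.eq_zero_or_eq_zero_of_mul_eq_zero
    (hw.analyticOnNhd isOpen_compl_singleton) (hu.analyticOnNhd isOpen_compl_singleton)
    (fun z hz => h z hz) isPreconnected_compl_zero with h1 | h1
  · exact absurd (h1 z₁ hz₁) hw₁
  · exact h1 z hz

/-- With S = P k = Q h, the functions b = c P h and g = c̄ Q k continue a² S and a⁻² S and satisfy b
g = S². Their symmetries follow from those of S, P and Q after cancelling P or Q. -/
theorem mem_punctured_of_blaschke {r : ℝ} (hr : 0 < r) {q : ℂ} {N : ℕ} {α : Fin N → ℂ} {c : ℂ}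
    (hc : ‖c‖ = 1) (hα : ∀ j, α j ∈ spectralSet r q)
    (hinj : Function.Injective fun j => α j ^ 2) {a : ℂ → ℂ}
    (ha : ∀ z ∈ Metric.sphere (0 : ℂ) r, a z ≠ 0)
    (heq : ∀ l ∈ Metric.sphere (0 : ℂ) r,
      a l ^ 2 = c * ∏ j, (α j ^ 2 - l ^ 2) / (1 - conj (α j) ^ 2 * l ^ 2)) :
    (fun l => diagLoop a l * cylinderMonodromy q l * (diagLoop a l)⁻¹) ∈
      LambdaPuncturedSU r := by
  have hα0 : ∀ j, α j ≠ 0 := fun j => norm_pos_iff.1 (hr.trans (hα j).1.1)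
  have hαc : ∀ j, conj (α j) ≠ 0 := fun j => by simpa using hα0 j
  have hS0 : ∀ j, cylSinh q (α j) = 0 := fun j => (mem_spectralSet_iff.1 (hα j)).2
  have hcc : c * conj c = 1 := by
    rw [Complex.mul_conj, Complex.normSq_eq_norm_sq, hc]; simp
  set P : ℂ → ℂ := fun z => ∏ j, (α j ^ 2 - 1 * z ^ 2) with hP
  set Q : ℂ → ℂ := fun z => ∏ j, (1 - conj (α j) ^ 2 * z ^ 2) with hQ
  have hPd : Differentiable ℂ P := Differentiable.fun_finsetProd fun j _ => by fun_prop
  have hQd : Differentiable ℂ Q := Differentiable.fun_finsetProd fun j _ => by fun_prop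
  obtain ⟨k, hk, hPk⟩ : ∃ h : ℂ → ℂ, DifferentiableOn ℂ h {0}ᶜ ∧
      ∀ z, cylSinh q z = P z * h z :=
    exists_cylSinh_eq_prod_mul (fun j => α j ^ 2) (fun _ => 1) α (fun _ => one_ne_zero) hα0
      (fun j => (one_mul _).symm) hinj hS0
  obtain ⟨h, hh, hQh⟩ : ∃ h : ℂ → ℂ, DifferentiableOn ℂ h {0}ᶜ ∧
      ∀ z, cylSinh q z = Q z * h z :=
    exists_cylSinh_eq_prod_mul (fun _ => 1) (fun j => conj (α j) ^ 2) (fun j => 1 / conj (α j))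
      (fun j => pow_ne_zero 2 (hαc j)) (fun j => one_div_ne_zero (hαc j))
      (fun j => by have := hαc j; field_simp)
      (fun i j hij => hinj (by
        have h1 : (conj (α i) ^ 2)⁻¹ = (conj (α j) ^ 2)⁻¹ := by simpa using hij
        have h2 := congrArg conj (inv_injective h1)
        simpa using h2))
      (fun j => by rw [cylSinh_one_div_conj, hS0, map_zero, neg_zero])
  have hPneg : ∀ z, P (-z) = P z := fun z => by simp [hP]
  have hQneg : ∀ z, Q (-z) = Q z := fun z => by simp [hQ]
  have hPr : ∀ z ∈ Metric.sphere (0 : ℂ) r, P z ≠ 0 := by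
    intro z hz
    have hz' : ‖z‖ = r := by simpa using hz
    refine Finset.prod_ne_zero_iff.2 fun j _ h0 => ?_
    have h1 : α j ^ 2 = z ^ 2 := by linear_combination h0
    have h2 := congrArg norm h1
    rw [norm_pow, norm_pow, hz'] at h2
    have := (hα j).1.1
    have h3 := pow_lt_pow_left₀ this hr.le two_ne_zero
    exact h3.ne' h2
  have hQr : ∀ z ∈ Metric.sphere (0 : ℂ) r, Q z ≠ 0 := by
    intro z hz
    have hz' : ‖z‖ = r := by simpa using hz
    refine Finset.prod_ne_zero_iff.2 fun j _ h0 => ?_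
    have h1 : (1 : ℂ) = (conj (α j) * z) ^ 2 := by linear_combination h0
    have h2 := congrArg norm h1
    rw [norm_pow, norm_mul, RCLike.norm_conj, hz', norm_one] at h2
    have h3 : ‖α j‖ * r < 1 := (lt_div_iff₀ hr).1 (hα j).1.2
    have h4 := pow_lt_one₀ (by positivity) h3 two_ne_zero
    exact h4.ne h2.symm
  have hr0 : (r : ℂ) ≠ 0 := by exact_mod_cast hr.ne'
  have hrs : (r : ℂ) ∈ Metric.sphere (0 : ℂ) r := by simp [hr.le]
  set b : ℂ → ℂ := fun z => c * (P z * h z) with hb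
  set g : ℂ → ℂ := fun z => conj c * (Q z * k z) with hg
  have hbd : DifferentiableOn ℂ b {0}ᶜ := (hPd.differentiableOn.fun_mul hh).const_mul c
  have hgd : DifferentiableOn ℂ g {0}ᶜ := (hQd.differentiableOn.fun_mul hk).const_mul _
  have hnegd : ∀ {f : ℂ → ℂ}, DifferentiableOn ℂ f {0}ᶜ →
      DifferentiableOn ℂ (fun z => f (-z)) {0}ᶜ := fun hf =>
    hf.comp differentiable_neg.differentiableOn fun z hz => by simpa using hz
  have hbg : ∀ z, b z * g z = cylSinh q z ^ 2 := by
    intro z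
    simp only [hb, hg]
    rw [sq]; nth_rw 1 [hPk]; rw [hQh]
    linear_combination (P z * h z * (Q z * k z)) * hcc
  have hbodd : ∀ z, z ≠ 0 → b (-z) = -b z := by
    intro z hz
    have := eq_zero_of_mul_eq_zero_on_compl_zero (u := fun z => b (-z) + b z) (w := Q)
      ((hnegd hbd).fun_add hbd) hQd.differentiableOn (fun z _ => by
        have h1 := hQh (-z)
        rw [cylSinh_neg, hQneg, hQh z] at h1
        simp only [hb, hPneg]
        linear_combination (-c * P z) * h1) hr0 (hQr _ hrs) hz
    exact eq_neg_of_add_eq_zero_left this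
  have hgodd : ∀ z, z ≠ 0 → g (-z) = -g z := by
    intro z hz
    have := eq_zero_of_mul_eq_zero_on_compl_zero (u := fun z => g (-z) + g z) (w := P)
      ((hnegd hgd).fun_add hgd) hPd.differentiableOn (fun z _ => by
        have h1 := hPk (-z)
        rw [cylSinh_neg, hPneg, hPk z] at h1
        simp only [hg, hQneg]
        linear_combination (-conj c * Q z) * h1) hr0 (hPr _ hrs) hz
    exact eq_neg_of_add_eq_zero_left this
  have hPstar : ∀ z, z ≠ 0 → conj (P (1 / conj z)) = (-(z ^ 2)⁻¹) ^ N * Q z := by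
    intro z hz
    simp only [hP, hQ]
    have hpow : (-(z ^ 2)⁻¹) ^ N = ∏ _j : Fin N, -(z ^ 2)⁻¹ := by simp
    rw [map_prod, hpow, ← Finset.prod_mul_distrib]
    refine Finset.prod_congr rfl fun j _ => ?_
    simp only [map_sub, map_pow, map_mul, map_div₀, map_one, Complex.conj_conj]
    field_simp
    ring
  have hQstar : ∀ z, z ≠ 0 → conj (Q (1 / conj z)) = (-(z ^ 2)⁻¹) ^ N * P z := by
    intro z hz
    simp only [hP, hQ]
    have hpow : (-(z ^ 2)⁻¹) ^ N = ∏ _j : Fin N, -(z ^ 2)⁻¹ := by simp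
    rw [map_prod, hpow, ← Finset.prod_mul_distrib]
    refine Finset.prod_congr rfl fun j _ => ?_
    simp only [map_sub, map_pow, map_mul, map_div₀, map_one, Complex.conj_conj]
    field_simp
    ring
  have hstar : ∀ z, z ≠ 0 → conj (b (1 / conj z)) + g z = 0 := by
    intro z hz
    refine eq_zero_of_mul_eq_zero_on_compl_zero
      (u := fun z => conj (b (1 / conj z)) + g z) (w := P)
      ((differentiableOn_conj_comp_one_div_conj hbd).fun_add hgd) hPd.differentiableOn
      (fun z hz => ?_) hr0 (hPr _ hrs) hz
    have h1 := congrArg conj (hQh (1 / conj z))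
    rw [cylSinh_one_div_conj, map_neg, Complex.conj_conj, map_mul, hQstar z hz] at h1
    simp only [hb, hg, map_mul, hPstar z hz]
    linear_combination (-conj c * Q z) * h1 - (conj c * Q z) * hPk z
  have hcosh := (differentiableOn_cylExponent q).ccosh
  have hdet : ∀ z, Complex.cosh (cylExponent q z) * Complex.cosh (cylExponent q z) - b z * g z
      = 1 := by
    intro z
    rw [hbg, ← Complex.cosh_sq_sub_sinh_sq (cylExponent q z), cylSinh]; ring
  refine ⟨fun z => !![Complex.cosh (cylExponent q z), b z; g z, Complex.cosh (cylExponent q z)],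
    ⟨?_, ?_, ?_, ?_⟩, ?_⟩
  · intro i j
    fin_cases i <;> fin_cases j
    exacts [hcosh, hbd, hgd, hcosh]
  · intro z _
    rw [Matrix.det_fin_two]
    exact hdet z
  · intro z hz
    rw [twist, sigma3_inv]
    ext i j
    fin_cases i <;> fin_cases j <;>
      simp [sigma3, Matrix.mul_apply, Fin.sum_univ_two, hbodd z hz, hgodd z hz]
  · intro z hz
    have hz1 : ‖z‖ = 1 := by simpa using hz
    have hz0 : z ≠ 0 := norm_pos_iff.1 (by rw [hz1]; norm_num)
    have hbz : conj (b z) = -g z := by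
      have := hstar z hz0
      rw [conj_one_div_conj_eq hz1] at this
      exact eq_neg_of_add_eq_zero_left this
    have hgz : conj (g z) = -b z := by
      rw [← neg_eq_iff_eq_neg, ← map_neg, ← hbz, Complex.conj_conj]
    have hcz : conj (Complex.cosh (cylExponent q z)) = Complex.cosh (cylExponent q z) := by
      have := cylExponent_one_div_conj q z
      rw [conj_one_div_conj_eq hz1] at this
      rw [← Complex.cosh_conj, ← neg_neg (conj (cylExponent q z)), ← this, Complex.cosh_neg]
    rw [Matrix.mem_specialUnitaryGroup_iff, Matrix.mem_unitaryGroup_iff', Matrix.det_fin_two]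
    refine ⟨?_, hdet z⟩
    have hd := hdet z
    ext i j
    fin_cases i <;> fin_cases j
    all_goals simp [Matrix.mul_apply, Fin.sum_univ_two, Matrix.star_apply, hbz, hgz, hcz]
    · linear_combination hd
    · ring
    · ring
    · linear_combination hd
  · intro z hz
    have hPz := hPr z hz
    have hQz := hQr z hz
    have hc0 : c ≠ 0 := left_ne_zero_of_mul_eq_one hcc
    have haz : a z ^ 2 = c * (P z / Q z) := by
      rw [heq z hz, Finset.prod_div_distrib]; simp [hP, hQ]
    have hci : c⁻¹ = conj c := inv_eq_of_mul_eq_one_right hcc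
    have e1 : b z = a z ^ 2 * cylSinh q z := by
      rw [haz, hQh]; simp only [hb]; field_simp
    have e2 : g z = (a z ^ 2)⁻¹ * cylSinh q z := by
      rw [haz, hPk]; simp only [hg, ← hci]; field_simp
    simp only [diagLoop_mul_cylinderMonodromy_mul_inv q z a (ha z hz), ← e1, ← e2]

/-! ### Square roots of Blaschke products and the unitary extension. -/

/-- A Blaschke factor in `z²`, with the removable singularity for unimodular `α` removed. -/
noncomputable def blaschkeFactor (α z : ℂ) : ℂ :=
  open Classical in
  if ‖α‖ = 1 then α ^ 2 else (α ^ 2 - z ^ 2) / (1 - conj α ^ 2 * z ^ 2)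

theorem blaschkeFactor_eq {α z : ℂ} (h : 1 - conj α ^ 2 * z ^ 2 ≠ 0) :
    blaschkeFactor α z = (α ^ 2 - z ^ 2) / (1 - conj α ^ 2 * z ^ 2) := by
  unfold blaschkeFactor
  split_ifs with h1
  · have hαα : α * conj α = 1 := by
      rw [Complex.mul_conj, Complex.normSq_eq_norm_sq, h1]; simp
    rw [eq_div_iff h]
    linear_combination (-z ^ 2 * (α * conj α + 1)) * hαα
  · rfl

/-- The principal branch of the square root. -/
noncomputable def csqrt (w : ℂ) : ℂ := w ^ ((2 : ℕ) : ℂ)⁻¹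

theorem csqrt_sq (w : ℂ) : csqrt w ^ 2 = w := Complex.cpow_nat_inv_pow w two_ne_zero

theorem exists_sqrt_prod {N : ℕ} {V : Set ℂ} {ρ : Fin N → ℂ → ℂ} (c : ℂ)
    (h : ∀ j, ∃ s : ℂ → ℂ, DifferentiableOn ℂ s V ∧ ∀ z ∈ V, s z ^ 2 = ρ j z) :
    ∃ s : ℂ → ℂ, DifferentiableOn ℂ s V ∧ ∀ z ∈ V, s z ^ 2 = c * ∏ j, ρ j z := by
  choose s hs hs2 using h
  refine ⟨fun z => csqrt c * ∏ j, s j z, ?_, fun z hz => ?_⟩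
  · exact (DifferentiableOn.fun_finsetProd fun j _ => hs j).const_mul _
  · rw [mul_pow, ← Finset.prod_pow, csqrt_sq]
    congr 1
    exact Finset.prod_congr rfl fun j _ => hs2 j z hz

theorem differentiableOn_csqrt_comp {u : ℂ → ℂ} {V : Set ℂ} (hu : DifferentiableOn ℂ u V)
    (h : ∀ z ∈ V, u z ∈ Complex.slitPlane) : DifferentiableOn ℂ (fun z => csqrt (u z)) V :=
  fun z hz => (hu z hz).cpow_const (h z hz)

theorem csqrt_ne_zero {w : ℂ} (h : w ≠ 0) : csqrt w ≠ 0 := fun h0 => h (by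
  rw [← csqrt_sq w, h0]; ring)

theorem one_sub_mem_slitPlane {w : ℂ} (h : ‖w‖ < 1) : 1 - w ∈ Complex.slitPlane := by
  have := Complex.mem_slitPlane_of_norm_lt_one (z := -w) (by simpa using h)
  rwa [← sub_eq_add_neg] at this

theorem exists_sqrt_blaschkeFactor_of_slitPlane {α : ℂ} (hα : α ≠ 0) {V : Set ℂ}
    (h1 : ∀ z ∈ V, 1 - z ^ 2 / α ^ 2 ∈ Complex.slitPlane)
    (h2 : ∀ z ∈ V, 1 - conj α ^ 2 * z ^ 2 ∈ Complex.slitPlane) :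
    ∃ s : ℂ → ℂ, DifferentiableOn ℂ s V ∧ ∀ z ∈ V, s z ^ 2 = blaschkeFactor α z := by
  refine ⟨fun z => α * csqrt (1 - z ^ 2 / α ^ 2) / csqrt (1 - conj α ^ 2 * z ^ 2), ?_, ?_⟩
  · refine DifferentiableOn.fun_div ?_ ?_ fun z hz =>
      csqrt_ne_zero (Complex.slitPlane_ne_zero (h2 z hz))
    · exact (differentiableOn_csqrt_comp (by fun_prop) h1).const_mul α
    · exact differentiableOn_csqrt_comp (by fun_prop) h2
  · intro z hz
    rw [blaschkeFactor_eq (Complex.slitPlane_ne_zero (h2 z hz)), div_pow, mul_pow, csqrt_sq,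
      csqrt_sq]
    congr 1
    field_simp

/-- The zeros ±α lie on one side of the annulus and the poles on the other, or the factor is
constant. Hence the winding number is even: extracting -z², with root iz, from the numerator (|α| ≤
t), or -ᾱ² z² from the denominator (|α| ≥ 1/t), leaves terms 1 - w with |w| < 1, which have
principal roots. -/
theorem exists_sqrt_blaschkeFactor_annulus {t : ℝ} (ht : 0 < t) {α : ℂ} (hα : α ≠ 0)
    (h : ‖α‖ = 1 ∨ ‖α‖ ≤ t ∨ 1 / t ≤ ‖α‖) :
    ∃ s : ℂ → ℂ, DifferentiableOn ℂ s (annulus t) ∧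
      ∀ z ∈ annulus t, s z ^ 2 = blaschkeFactor α z := by
  have hz0 : ∀ z ∈ annulus t, z ≠ 0 := fun z hz => norm_pos_iff.1 (ht.trans hz.1)
  have hαc : conj α ≠ 0 := by simpa using hα
  have hαn : 0 < ‖α‖ := norm_pos_iff.2 hα
  rcases h with h | h | h
  · exact ⟨fun _ => α, differentiableOn_const α, fun z _ => by simp [blaschkeFactor, h]⟩
  · have h1 : ∀ z ∈ annulus t, 1 - α ^ 2 / z ^ 2 ∈ Complex.slitPlane := by
      intro z hz
      apply one_sub_mem_slitPlane
      rw [← div_pow, norm_pow, norm_div]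
      refine pow_lt_one₀ (by positivity) ?_ two_ne_zero
      rw [div_lt_one (norm_pos_iff.2 (hz0 z hz))]
      exact h.trans_lt hz.1
    have h2 : ∀ z ∈ annulus t, 1 - conj α ^ 2 * z ^ 2 ∈ Complex.slitPlane := by
      intro z hz
      apply one_sub_mem_slitPlane
      rw [← mul_pow, norm_pow, norm_mul, RCLike.norm_conj]
      refine pow_lt_one₀ (by positivity) ?_ two_ne_zero
      calc ‖α‖ * ‖z‖ < t * (1 / t) :=
            mul_lt_mul' h hz.2 (norm_nonneg _) ht
        _ = 1 := by field_simp
    refine ⟨fun z => Complex.I * z * csqrt (1 - α ^ 2 / z ^ 2) / csqrt (1 - conj α ^ 2 * z ^ 2),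
      ?_, ?_⟩
    · refine DifferentiableOn.fun_div (DifferentiableOn.fun_mul (by fun_prop) ?_) ?_ fun z hz =>
        csqrt_ne_zero (Complex.slitPlane_ne_zero (h2 z hz))
      · refine differentiableOn_csqrt_comp ?_ h1
        exact (DifferentiableOn.fun_div (by fun_prop) (by fun_prop)
          fun z hz => pow_ne_zero 2 (hz0 z hz)).const_sub 1
      · exact differentiableOn_csqrt_comp (by fun_prop) h2
    · intro z hz
      have := hz0 z hz
      rw [blaschkeFactor_eq (Complex.slitPlane_ne_zero (h2 z hz)), div_pow, mul_pow, mul_pow,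
        csqrt_sq, csqrt_sq, Complex.I_sq]
      congr 1
      field_simp
      ring
  · have h1 : ∀ z ∈ annulus t, 1 - z ^ 2 / α ^ 2 ∈ Complex.slitPlane := by
      intro z hz
      apply one_sub_mem_slitPlane
      rw [← div_pow, norm_pow, norm_div]
      refine pow_lt_one₀ (by positivity) ?_ two_ne_zero
      rw [div_lt_one hαn]
      exact hz.2.trans_le h
    have h2 : ∀ z ∈ annulus t, 1 - 1 / (conj α ^ 2 * z ^ 2) ∈ Complex.slitPlane := by
      intro z hz
      apply one_sub_mem_slitPlane
      rw [← mul_pow, norm_div, norm_one, norm_pow, norm_mul, RCLike.norm_conj]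
      have h3 : 1 < ‖α‖ * ‖z‖ := by
        calc 1 = 1 / t * t := by field_simp
          _ < ‖α‖ * ‖z‖ := mul_lt_mul' h hz.1 ht.le hαn
      rw [div_lt_one (by positivity)]
      exact one_lt_pow₀ h3 two_ne_zero
    have hfac : ∀ z ∈ annulus t, 1 - conj α ^ 2 * z ^ 2 =
        -(conj α ^ 2 * z ^ 2) * (1 - 1 / (conj α ^ 2 * z ^ 2)) := by
      intro z hz
      have := hz0 z hz
      field_simp
      ring
    refine ⟨fun z => α * csqrt (1 - z ^ 2 / α ^ 2) /
      (Complex.I * conj α * z * csqrt (1 - 1 / (conj α ^ 2 * z ^ 2))), ?_, ?_⟩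
    · refine DifferentiableOn.fun_div ?_ (DifferentiableOn.fun_mul (by fun_prop) ?_) fun z hz =>
        mul_ne_zero (mul_ne_zero (mul_ne_zero Complex.I_ne_zero hαc) (hz0 z hz))
          (csqrt_ne_zero (Complex.slitPlane_ne_zero (h2 z hz)))
      · exact (differentiableOn_csqrt_comp (by fun_prop) h1).const_mul α
      · refine differentiableOn_csqrt_comp ?_ h2
        exact (DifferentiableOn.fun_div (by fun_prop) (by fun_prop)
          fun z hz => mul_ne_zero (pow_ne_zero 2 hαc) (pow_ne_zero 2 (hz0 z hz))).const_sub 1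
    · intro z hz
      have hz' := hz0 z hz
      have hne := Complex.slitPlane_ne_zero (h2 z hz)
      have hne' : 1 - conj α ^ 2 * z ^ 2 ≠ 0 := by
        rw [hfac z hz]
        exact mul_ne_zero (neg_ne_zero.2 (mul_ne_zero (pow_ne_zero 2 hαc) (pow_ne_zero 2 hz'))) hne
      rw [blaschkeFactor_eq hne', hfac z hz]
      simp only [div_pow, mul_pow, csqrt_sq, Complex.I_sq]
      have e1 : α ^ 2 * (1 - z ^ 2 / α ^ 2) = α ^ 2 - z ^ 2 := by field_simp
      rw [e1]
      congr 1
      ring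

/-- Reflection in the unit circle exchanges numerator and denominator up to the common factor -z⁻².
The condition on |α| keeps zeros and poles out of the annulus. -/
theorem blaschkeFactor_mul_conj {t : ℝ} (ht : 0 < t) {α : ℂ} (hα : α ≠ 0)
    (h : ‖α‖ = 1 ∨ ‖α‖ ≤ t ∨ 1 / t ≤ ‖α‖) {z : ℂ} (hz : z ∈ annulus t) :
    blaschkeFactor α z * conj (blaschkeFactor α (1 / conj z)) = 1 := by
  have hz0 : z ≠ 0 := norm_pos_iff.1 (ht.trans hz.1)
  have hzc : conj z ≠ 0 := by simpa using hz0
  have hαn : 0 < ‖α‖ := norm_pos_iff.2 hα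
  unfold blaschkeFactor
  split_ifs with h1
  · have hαα : α * conj α = 1 := by
      rw [Complex.mul_conj, Complex.normSq_eq_norm_sq, h1]; simp
    rw [map_pow, ← mul_pow, hαα, one_pow]
  · replace h := h.resolve_left h1
    have hne1 : α ^ 2 - z ^ 2 ≠ 0 := by
      intro h0
      have h2 := congrArg norm (sub_eq_zero.1 h0)
      rw [norm_pow, norm_pow] at h2
      have h3 := (pow_left_inj₀ (norm_nonneg _) (norm_nonneg _) two_ne_zero).1 h2
      rcases h with h | h
      · exact (h.trans_lt hz.1).ne h3
      · exact (hz.2.trans_le h).ne' h3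
    have hne2 : 1 - conj α ^ 2 * z ^ 2 ≠ 0 := by
      intro h0
      have h2 := congrArg norm (sub_eq_zero.1 h0)
      rw [norm_one, ← mul_pow, norm_pow, norm_mul, RCLike.norm_conj] at h2
      have h3 := (pow_eq_one_iff_of_nonneg (by positivity) two_ne_zero).1 h2.symm
      rcases h with h | h
      · have : ‖α‖ * ‖z‖ < t * (1 / t) := mul_lt_mul' h hz.2 (norm_nonneg _) ht
        rw [h3, mul_one_div_cancel ht.ne'] at this
        exact lt_irrefl _ this
      · have : 1 / t * t < ‖α‖ * ‖z‖ := mul_lt_mul' h hz.1 ht.le hαn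
        rw [h3, one_div_mul_cancel ht.ne'] at this
        exact lt_irrefl _ this
    simp only [map_div₀, map_sub, map_pow, map_mul, map_one, Complex.conj_conj]
    have e1 : conj α ^ 2 - (1 / z) ^ 2 = -(z ^ 2)⁻¹ * (1 - conj α ^ 2 * z ^ 2) := by
      field_simp; ring
    have e2 : 1 - α ^ 2 * (1 / z) ^ 2 = -(z ^ 2)⁻¹ * (α ^ 2 - z ^ 2) := by
      field_simp; ring
    rw [e1, e2, mul_div_mul_left _ _ (neg_ne_zero.2 (inv_ne_zero (pow_ne_zero 2 hz0))),
      div_mul_div_comm, div_eq_one_iff_eq (mul_ne_zero hne2 hne1)]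
    ring

theorem exists_radius {N : ℕ} (α : Fin N → ℂ) {r : ℝ} (hr : r < 1) :
    ∃ t, r ≤ t ∧ t < 1 ∧ ∀ j, ‖α j‖ = 1 ∨ ‖α j‖ ≤ t ∨ 1 / t ≤ ‖α j‖ := by
  have key : ∀ j, ∀ᶠ t in 𝓝[<] (1 : ℝ), ‖α j‖ = 1 ∨ ‖α j‖ ≤ t ∨ 1 / t ≤ ‖α j‖ := by
    intro j
    rcases lt_trichotomy ‖α j‖ 1 with h | h | h
    · filter_upwards [mem_nhdsWithin_of_mem_nhds (Ioi_mem_nhds h)] with t ht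
      exact Or.inr (Or.inl (le_of_lt ht))
    · exact Eventually.of_forall fun _ => Or.inl h
    · have hpos : 0 < ‖α j‖ := one_pos.trans h
      have h' : 1 / ‖α j‖ < 1 := (div_lt_one hpos).2 h
      filter_upwards [mem_nhdsWithin_of_mem_nhds (Ioi_mem_nhds h')] with t ht
      have ht0 : 0 < t := (by positivity : 0 < 1 / ‖α j‖).trans ht
      exact Or.inr (Or.inr ((one_div_lt ht0 hpos).2 ht).le)
  obtain ⟨t, h1, h2, h3⟩ := ((eventually_all.2 key).and
    (Filter.Eventually.and (mem_nhdsWithin_of_mem_nhds (Ioi_mem_nhds hr)) self_mem_nhdsWithin)).exists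
  exact ⟨t, le_of_lt h2, h3, h1⟩

/-- There is a sector in which none of the numbers `z² β_j` is real. -/
theorem exists_sector {N : ℕ} (β : Fin N → ℂ) (hβ : ∀ j, β j ≠ 0) :
    ∃ φ ε : ℝ, 0 < ε ∧ ∀ w : ℂ, |w.im - φ| < ε → ∀ j, (Complex.exp w ^ 2 * β j).im ≠ 0 := by
  -- This is the imaginary part of e^{2iθ} β_j. At θ = 0 either it or its derivative 2 Re β_j is
  -- nonzero, so it is nonzero for all small θ ≠ 0.
  set m : Fin N → ℝ → ℝ := fun j θ =>
    Real.cos (2 * θ) * (β j).im + Real.sin (2 * θ) * (β j).re with hm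
  have key : ∀ j, ∀ᶠ θ in 𝓝[≠] (0 : ℝ), m j θ ≠ 0 := by
    intro j
    by_cases h : (β j).im = 0
    · have hre : (β j).re ≠ 0 := fun h' => hβ j (Complex.ext h' h)
      have h2 : HasDerivAt (fun θ : ℝ => 2 * θ) 2 0 := by
        simpa using (hasDerivAt_id (0 : ℝ)).const_mul 2
      have hd := (h2.cos.mul_const (β j).im).fun_add (h2.sin.mul_const (β j).re)
      exact hd.eventually_ne (by simp [hre])
    · have hc : Continuous (m j) := by simp only [hm]; fun_prop
      have : m j 0 ≠ 0 := by simpa [hm] using h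
      exact mem_nhdsWithin_of_mem_nhds (hc.continuousAt.eventually_ne this)
  obtain ⟨φ, hφ⟩ := (eventually_all.2 key).exists
  have hev : ∀ᶠ θ in 𝓝 φ, ∀ j, m j θ ≠ 0 := eventually_all.2 fun j => by
    have hc : Continuous (m j) := by simp only [hm]; fun_prop
    exact hc.continuousAt.eventually_ne (hφ j)
  obtain ⟨ε, hε, h⟩ := Metric.eventually_nhds_iff.1 hev
  refine ⟨φ, ε, hε, fun w hw j => ?_⟩
  have hmj := h (show dist w.im φ < ε from hw) j
  have : (Complex.exp w ^ 2 * β j).im = Real.exp (2 * w.re) * m j w.im := by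
    rw [← Complex.exp_nat_mul, Complex.mul_im, Complex.exp_re, Complex.exp_im]
    simp [hm]; ring
  rw [this]
  exact mul_ne_zero (Real.exp_pos _).ne' hmj

theorem one_div_conj_mem_annulus {t : ℝ} (ht : 0 < t) {z : ℂ} (hz : z ∈ annulus t) :
    1 / conj z ∈ annulus t := by
  have hz0 : 0 < ‖z‖ := ht.trans hz.1
  rw [annulus, Set.mem_ofPred_eq, norm_div, norm_one, RCLike.norm_conj]
  exact ⟨(lt_one_div ht hz0).2 hz.2, one_div_lt_one_div_of_lt ht hz.1⟩

theorem annulus_eq_exp_image {t : ℝ} (ht : 0 < t) :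
    annulus t = Complex.exp '' {w | Real.log t < w.re ∧ w.re < -Real.log t} := by
  ext z
  constructor
  · intro hz
    have hz0 : z ≠ 0 := norm_pos_iff.1 (ht.trans hz.1)
    refine ⟨Complex.log z, ⟨?_, ?_⟩, Complex.exp_log hz0⟩
    · rw [Complex.log_re]; exact Real.log_lt_log ht hz.1
    · rw [Complex.log_re, ← Real.log_inv, ← one_div]
      exact Real.log_lt_log (norm_pos_iff.2 hz0) hz.2
  · rintro ⟨w, ⟨h1, h2⟩, rfl⟩
    rw [annulus, Set.mem_ofPred_eq, Complex.norm_exp]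
    refine ⟨(Real.log_lt_iff_lt_exp ht).1 h1, ?_⟩
    rw [one_div, ← Real.exp_log (inv_pos.2 ht), Real.log_inv]
    exact Real.exp_lt_exp.2 h2

theorem convex_re_Ioo_im_ball (x y φ ε : ℝ) :
    Convex ℝ {w : ℂ | (x < w.re ∧ w.re < y) ∧ |w.im - φ| < ε} := by
  have h1 : Convex ℝ (Complex.reLm ⁻¹' Set.Ioo x y) := (convex_Ioo x y).linear_preimage _
  have h2 : Convex ℝ (Complex.imLm ⁻¹' Metric.ball φ ε) := (convex_ball φ ε).linear_preimage _
  exact h1.inter h2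

theorem isPreconnected_annulus {t : ℝ} (ht : 0 < t) : IsPreconnected (annulus t) := by
  rw [annulus_eq_exp_image ht]
  refine IsPreconnected.image (Convex.isPreconnected ?_) _ Complex.continuous_exp.continuousOn
  exact (convex_Ioo (Real.log t) (-Real.log t)).linear_preimage Complex.reLm

theorem isOpen_annulus (t : ℝ) : IsOpen (annulus t) :=
  (isOpen_lt continuous_const continuous_norm).inter (isOpen_lt continuous_norm continuous_const)

/-- Two square roots on overlapping open sets can be glued if the overlap is connected. -/
theorem exists_sqrt_union {R : ℂ → ℂ} {V W : Set ℂ} (hV : IsOpen V) (hW : IsOpen W)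
    (hVW : IsPreconnected (V ∩ W)) (hR : ∀ z ∈ W, R z ≠ 0)
    (h1 : ∃ s : ℂ → ℂ, DifferentiableOn ℂ s V ∧ ∀ z ∈ V, s z ^ 2 = R z)
    (h2 : ∃ s : ℂ → ℂ, DifferentiableOn ℂ s W ∧ ∀ z ∈ W, s z ^ 2 = R z) :
    ∃ s : ℂ → ℂ, DifferentiableOn ℂ s (V ∪ W) ∧ ∀ z ∈ V ∪ W, s z ^ 2 = R z := by
  classical
  obtain ⟨s, hs, hs2⟩ := h1
  obtain ⟨u, hu, hu2, hsu⟩ : ∃ u : ℂ → ℂ, DifferentiableOn ℂ u W ∧ (∀ z ∈ W, u z ^ 2 = R z) ∧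
      Set.EqOn s u (V ∩ W) := by
    obtain ⟨u, hu, hu2⟩ := h2
    rcases hVW.eq_or_eq_neg_of_sq_eq (f := s) (g := u)
      (hs.continuousOn.mono Set.inter_subset_left) (hu.continuousOn.mono Set.inter_subset_right)
      (fun z hz => by simp only [Pi.pow_apply, hs2 z hz.1, hu2 z hz.2])
      (fun {z} hz h0 => hR z hz.2 (by rw [← hu2 z hz.2, h0]; ring)) with h | h
    · exact ⟨u, hu, hu2, h⟩
    · exact ⟨-u, hu.neg, fun z hz => by simp [hu2 z hz], h⟩
  have eV : ∀ z ∈ V, (if z ∈ V then s z else u z) = s z := fun z hz => if_pos hz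
  have eW : ∀ z ∈ W, (if z ∈ V then s z else u z) = u z := fun z hz => by
    split_ifs with h
    exacts [hsu ⟨h, hz⟩, rfl]
  refine ⟨fun z => if z ∈ V then s z else u z, ?_, ?_⟩
  · exact DifferentiableOn.union_of_isOpen (hs.congr eV) (hu.congr eW) hV hW
  · rintro z (hz | hz)
    · simp only [eV z hz, hs2 z hz]
    · simp only [eW z hz, hu2 z hz]

/-- On the disc the extension of a and the root s have the same square, so they agree up to one
global sign; with this sign corrected, s extends a. -/
theorem extendsUnitarily_of_sqrt {n : ℕ∞} {r : ℝ} (hr : 0 < r) {a R : ℂ → ℂ}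
    (ha : diagLoop a ∈ LambdaPlus n r) {t : ℝ} (hrt : r ≤ t) (ht : t < 1) {U : Set ℂ}
    (hU : IsOpen U) (hUc : IsConnected U) (hball : Metric.ball 0 r ⊆ U) (hann : annulus t ⊆ U)
    {s : ℂ → ℂ} (hs : DifferentiableOn ℂ s U) (hs2 : ∀ z ∈ U, s z ^ 2 = R z)
    (hR : ∀ z ∈ U, R z ≠ 0) (hRc : ∀ z ∈ annulus t, R z * conj (R (1 / conj z)) = 1)
    (haR : ∀ z ∈ Metric.sphere (0 : ℂ) r, a z ^ 2 = R z)
    (hRs : ∀ z ∈ Metric.sphere (0 : ℂ) r, ContinuousAt R z) :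
    ExtendsUnitarily r (diagLoop a) := by
  obtain ⟨hloop, G, hGh, hGb⟩ := ha
  have ht0 : 0 < t := hr.trans_le hrt
  have hne : ∀ z ∈ Metric.sphere (0 : ℂ) r, a z ≠ 0 := fun z hz =>
    ne_zero_of_isTwistedLoop_diagLoop hloop hz
  have hRd : DifferentiableOn ℂ R U := (hs.fun_pow 2).congr fun z hz => (hs2 z hz).symm
  have h0b : (0 : ℂ) ∈ Metric.ball (0 : ℂ) r := Metric.mem_ball_self hr
  have hlim : ∀ z ∈ Metric.sphere (0 : ℂ) r,
      Tendsto (fun w => G w 0 0) (𝓝[Metric.ball 0 r] z) (𝓝 (a z)) := fun z hz => by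
    simpa [diagLoop] using tendsto_apply (hGb z hz) 0 0
  have hGR : ∀ z ∈ Metric.ball (0 : ℂ) r, G z 0 0 ^ 2 = R z := by
    have hd := (hGh 0 0).fun_pow 2
    refine eqOn_ball_of_eqOn_punctured_ball hr
      (hd.differentiableAt (Metric.isOpen_ball.mem_nhds h0b)).continuousAt
      (hRd.differentiableAt (hU.mem_nhds (hball h0b))).continuousAt fun z hz => ?_
    refine sub_eq_zero.1 (eqOn_zero_of_tendsto_zero_sphere (D := fun z => G z 0 0 ^ 2 - R z)
      ((hd.fun_sub (hRd.mono hball)).mono Set.sdiff_subset) (fun w hw => ?_) z hz)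
    have := ((hlim w hw).pow 2).sub ((hRs w hw).tendsto.mono_left nhdsWithin_le_nhds)
    rwa [haR w hw, sub_self] at this
  obtain ⟨u, hu, hu2, hGu⟩ : ∃ u : ℂ → ℂ, DifferentiableOn ℂ u U ∧ (∀ z ∈ U, u z ^ 2 = R z) ∧
      Set.EqOn (fun z => G z 0 0) u (Metric.ball 0 r) := by
    rcases (convex_ball (0 : ℂ) r).isPreconnected.eq_or_eq_neg_of_sq_eq
      (f := fun z => G z 0 0) (g := s) (hGh 0 0).continuousOn (hs.continuousOn.mono hball)
      (fun z hz => by simp only [Pi.pow_apply, hGR z hz, hs2 z (hball hz)])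
      (fun {z} hz h0 => hR z (hball hz) (by rw [← hs2 z (hball hz), h0]; ring)) with h | h
    · exact ⟨s, hs, hs2, h⟩
    · exact ⟨-s, hs.neg, fun z hz => by simp [hs2 z hz], h⟩
  have hu0 : ∀ z ∈ U, u z ≠ 0 := fun z hz h0 => hR z hz (by rw [← hu2 z hz, h0]; ring)
  have hhol : HolomorphicOn (diagLoop u) U := by
    intro i j
    fin_cases i <;> fin_cases j
    exacts [hu, differentiableOn_const 0, differentiableOn_const 0,
      (differentiableOn_const 1).fun_div hu hu0]
  refine ⟨t, ⟨hrt, ht.le⟩, fun _ => ht, U, diagLoop u, hU, hUc, hball, hann, hhol,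
    ⟨fun i j => (hhol i j).mono hball, fun z hz => ?_⟩, ?_⟩
  · have hul : Tendsto u (𝓝[Metric.ball 0 r] z) (𝓝 (a z)) :=
      (hlim z hz).congr' (Filter.eventuallyEq_of_mem self_mem_nhdsWithin hGu)
    refine tendsto_pi_nhds.2 fun i => tendsto_pi_nhds.2 fun j => ?_
    fin_cases i <;> fin_cases j
    exacts [hul, tendsto_const_nhds, tendsto_const_nhds,
      tendsto_const_nhds.div hul (hne z hz)]
  · have hmaps : Set.MapsTo (fun z : ℂ => 1 / conj z) (annulus t) (annulus t) :=
      fun z hz => one_div_conj_mem_annulus ht0 hz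
    have hcu := hu.continuousOn.mono hann
    have hcinv : ContinuousOn (fun z : ℂ => 1 / conj z) (annulus t) :=
      continuousOn_const.div Complex.continuous_conj.continuousOn fun z hz => by
        simpa using norm_pos_iff.1 (ht0.trans hz.1)
    have hcp : ContinuousOn (fun z => u z * conj (u (1 / conj z))) (annulus t) :=
      hcu.mul (Complex.continuous_conj.comp_continuousOn (hcu.comp hcinv hmaps))
    have hp : ∀ z ∈ annulus t, u z * conj (u (1 / conj z)) = 1 := by
      rcases (isPreconnected_annulus ht0).eq_or_eq_neg_of_sq_eq (g := fun _ => (1 : ℂ)) hcp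
        continuousOn_const
        (fun z hz => by
          simp only [Pi.pow_apply]
          rw [mul_pow, ← map_pow, hu2 z (hann hz), hu2 _ (hann (hmaps hz)), hRc z hz, one_pow])
        (fun _ => one_ne_zero) with h | h
      · exact h
      -- The product u u^* squares to 1, so it is constantly 1 or -1 on the connected annulus. At
      -- the point 1 it equals |u(1)|² ≥ 0.
      · exfalso
        have h1 : (1 : ℂ) ∈ annulus t := ⟨by simpa using ht, by
          rw [norm_one]; exact one_lt_one_div ht0 ht⟩
        have h2 := h h1
        simp only [map_one, div_one, Complex.mul_conj, Pi.neg_apply] at h2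
        have h3 : Complex.normSq (u 1) = -1 := by exact_mod_cast h2
        linarith [Complex.normSq_nonneg (u 1)]
    intro z hz
    have h0 := hu0 z (hann hz)
    have h1 := hp z hz
    have h2 : conj (u (1 / conj z)) = (u z)⁻¹ := (inv_eq_of_mul_eq_one_right h1).symm
    have hinv : (diagLoop u z)⁻¹ = !![(u z)⁻¹, 0; 0, u z] := by
      apply Matrix.inv_eq_right_inv
      ext i j
      fin_cases i <;> fin_cases j <;> simp [diagLoop, Matrix.mul_apply, Fin.sum_univ_two, h0]
    rw [hinv, loopStar]
    ext i j
    fin_cases i <;> fin_cases j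
    · exact h2
    · simp [diagLoop]
    · simp [diagLoop]
    · have : conj (1 / u (1 / conj z)) = u z := by rw [map_div₀, map_one, h2, one_div, inv_inv]
      exact this

theorem extendsUnitarily_of_blaschke {n : ℕ∞} {r : ℝ} (hr0 : 0 < r) (hr1 : r ≤ 1) {N : ℕ}
    {α : Fin N → ℂ} {c : ℂ} (hc : ‖c‖ = 1) (hα : ∀ j, α j ∈ annulus r) {a : ℂ → ℂ}
    (ha : diagLoop a ∈ LambdaPlus n r)
    (heq : ∀ l ∈ Metric.sphere (0 : ℂ) r,
      a l ^ 2 = c * ∏ j, (α j ^ 2 - l ^ 2) / (1 - conj (α j) ^ 2 * l ^ 2)) :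
    ExtendsUnitarily r (diagLoop a) := by
  rcases hr1.lt_or_eq with hr | rfl
  swap
  · obtain ⟨-, G, hG⟩ := ha
    have hemp : annulus 1 = ∅ := by
      ext z
      simp only [annulus, Set.mem_ofPred_eq, Set.mem_empty_iff_false, iff_false, not_and, not_lt]
      intro h; simpa using h.le
    exact ⟨1, by simp, fun h => h, Metric.ball 0 1, G, Metric.isOpen_ball,
      (convex_ball (0 : ℂ) 1).isConnected (by simp), subset_rfl, by simp [hemp], hG.1, hG,
      by simp [hemp]⟩
  have hα0 : ∀ j, α j ≠ 0 := fun j => norm_pos_iff.1 (hr0.trans (hα j).1)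
  obtain ⟨t, hrt, ht, hαt⟩ := exists_radius α hr
  have ht0 : 0 < t := hr0.trans_le hrt
  have hlt : Real.log t < 0 := Real.log_neg ht0 ht
  -- One sector serves numerators and denominators: ᾱ² z² = |α|⁴ z²/α², so both 1 - z²/α² and 1 - ᾱ²
  -- z² are nonreal there.
  obtain ⟨φ, ε, hε, hsec⟩ := exists_sector (fun j => (α j ^ 2)⁻¹)
    fun j => inv_ne_zero (pow_ne_zero 2 (hα0 j))
  -- Logarithmic coordinates make the sector the image of a convex set. The lower bound lets it
  -- contain the point of modulus r/2 that joins it to the disc.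
  set T : Set ℂ := {w : ℂ | (Real.log (r / 2) - 1 < w.re ∧ w.re < -Real.log t) ∧ |w.im - φ| < ε}
    with hT
  have hTo : IsOpen T :=
    ((isOpen_lt continuous_const Complex.continuous_re).inter
      (isOpen_lt Complex.continuous_re continuous_const)).inter
      (isOpen_lt (Complex.continuous_im.sub continuous_const).abs continuous_const)
  have hlogr : Real.log (r / 2) < Real.log t := Real.log_lt_log (by positivity) (by linarith)
  set V : Set ℂ := Metric.ball 0 r ∪ Complex.exp '' T with hV
  have hVo : IsOpen V := Metric.isOpen_ball.union (Complex.isOpenMap_exp T hTo)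
  have hVc : IsPreconnected V := by
    refine IsPreconnected.union (Complex.exp (Real.log (r / 2) + φ * Complex.I)) ?_ ?_
      (convex_ball (0 : ℂ) r).isPreconnected
      ((convex_re_Ioo_im_ball _ _ _ _).isPreconnected.image _ Complex.continuous_exp.continuousOn)
    · rw [mem_ball_zero_iff, Complex.norm_exp]
      have hre : ((Real.log (r / 2) : ℂ) + φ * Complex.I).re = Real.log (r / 2) := by
        simp
      rw [hre, Real.exp_log (by positivity)]
      linarith
    · refine ⟨_, ⟨⟨?_, ?_⟩, ?_⟩, rfl⟩
      · simp
      · simp; linarith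
      · simpa using hε
  -- The disc misses the annulus because r ≤ t, so the overlap is a single sector piece, which is
  -- connected as gluing requires.
  have hmeet : V ∩ annulus t =
      Complex.exp '' {w : ℂ | (Real.log t < w.re ∧ w.re < -Real.log t) ∧ |w.im - φ| < ε} := by
    ext z
    constructor
    · rintro ⟨hz | ⟨w, ⟨⟨-, h2⟩, h3⟩, rfl⟩, hz'⟩
      · rw [mem_ball_zero_iff] at hz
        exact absurd hz'.1 (by linarith)
      · refine ⟨w, ⟨⟨?_, h2⟩, h3⟩, rfl⟩
        have := hz'.1
        rw [Complex.norm_exp] at this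
        exact (Real.log_lt_iff_lt_exp ht0).2 this
    · rintro ⟨w, ⟨⟨h1, h2⟩, h3⟩, rfl⟩
      refine ⟨Or.inr ⟨w, ⟨⟨by linarith, h2⟩, h3⟩, rfl⟩, ?_⟩
      rw [annulus_eq_exp_image ht0]
      exact ⟨w, ⟨h1, h2⟩, rfl⟩
  have hslit1 : ∀ j, ∀ z ∈ V, 1 - z ^ 2 / α j ^ 2 ∈ Complex.slitPlane := by
    rintro j z (hz | ⟨w, ⟨-, h3⟩, rfl⟩)
    · apply one_sub_mem_slitPlane
      rw [← div_pow, norm_pow, norm_div]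
      refine pow_lt_one₀ (by positivity) ?_ two_ne_zero
      rw [div_lt_one (hr0.trans (hα j).1)]
      exact (mem_ball_zero_iff.1 hz).trans (hα j).1
    · refine Complex.mem_slitPlane_iff.2 (Or.inr ?_)
      have := hsec w h3 j
      rw [div_eq_mul_inv, Complex.sub_im, Complex.one_im, zero_sub]
      exact neg_ne_zero.2 this
  have hslit2 : ∀ j, ∀ z ∈ V, 1 - conj (α j) ^ 2 * z ^ 2 ∈ Complex.slitPlane := by
    rintro j z (hz | ⟨w, ⟨-, h3⟩, rfl⟩)
    · apply one_sub_mem_slitPlane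
      rw [← mul_pow, norm_pow, norm_mul, RCLike.norm_conj]
      refine pow_lt_one₀ (by positivity) ?_ two_ne_zero
      have h1 := (hα j).2
      have h2 := mem_ball_zero_iff.1 hz
      rw [lt_div_iff₀ hr0] at h1
      have := hr0.trans (hα j).1
      nlinarith
    · refine Complex.mem_slitPlane_iff.2 (Or.inr ?_)
      have h4 := hsec w h3 j
      have h5 : conj (α j) ^ 2 * Complex.exp w ^ 2 =
          ((‖α j‖ ^ 4 : ℝ) : ℂ) * (Complex.exp w ^ 2 * (α j ^ 2)⁻¹) := by
        have h6 : ((‖α j‖ ^ 4 : ℝ) : ℂ) = (α j * conj (α j)) ^ 2 := by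
          rw [Complex.mul_conj, Complex.normSq_eq_norm_sq]; push_cast; ring
        rw [h6]
        have := hα0 j
        field_simp
      rw [h5, Complex.sub_im, Complex.one_im, zero_sub, Complex.im_ofReal_mul]
      have := hr0.trans (hα j).1
      exact neg_ne_zero.2 (mul_ne_zero (by positivity) h4)
  set R : ℂ → ℂ := fun z => c * ∏ j, blaschkeFactor (α j) z with hR
  have hc0 : c ≠ 0 := norm_ne_zero_iff.1 (by rw [hc]; norm_num)
  have hRc : ∀ z ∈ annulus t, R z * conj (R (1 / conj z)) = 1 := by
    intro z hz
    have hcc : c * conj c = 1 := by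
      rw [Complex.mul_conj, Complex.normSq_eq_norm_sq, hc]; simp
    simp only [hR]
    rw [map_mul, map_prod, mul_mul_mul_comm, hcc, one_mul, ← Finset.prod_mul_distrib]
    exact Finset.prod_eq_one fun j _ => blaschkeFactor_mul_conj ht0 (hα0 j) (hαt j) hz
  have hRA : ∀ z ∈ annulus t, R z ≠ 0 := fun z hz => left_ne_zero_of_mul_eq_one (hRc z hz)
  have hRV : ∀ z ∈ V, R z ≠ 0 := by
    intro z hz
    refine mul_ne_zero hc0 (Finset.prod_ne_zero_iff.2 fun j _ => ?_)
    have h1 := Complex.slitPlane_ne_zero (hslit1 j z hz)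
    have h2 := Complex.slitPlane_ne_zero (hslit2 j z hz)
    rw [blaschkeFactor_eq h2]
    refine div_ne_zero (fun h => h1 ?_) h2
    have := hα0 j
    field_simp
    rw [h, mul_zero]
  obtain ⟨s, hs, hs2⟩ := exists_sqrt_union hVo (isOpen_annulus t)
    (hmeet ▸ (convex_re_Ioo_im_ball _ _ _ _).isPreconnected.image _
      Complex.continuous_exp.continuousOn) hRA
    (exists_sqrt_prod c fun j => exists_sqrt_blaschkeFactor_of_slitPlane (hα0 j)
      (hslit1 j) (hslit2 j))
    (exists_sqrt_prod c fun j => exists_sqrt_blaschkeFactor_annulus ht0 (hα0 j) (hαt j))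
  have hden : ∀ z ∈ Metric.sphere (0 : ℂ) r, ∀ j, 1 - conj (α j) ^ 2 * z ^ 2 ≠ 0 := by
    intro z hz j
    apply Complex.slitPlane_ne_zero
    apply one_sub_mem_slitPlane
    rw [← mul_pow, norm_pow, norm_mul, RCLike.norm_conj, mem_sphere_zero_iff_norm.1 hz]
    exact pow_lt_one₀ (by positivity) ((lt_div_iff₀ hr0).1 (hα j).2) two_ne_zero
  refine extendsUnitarily_of_sqrt hr0 ha hrt ht (hVo.union (isOpen_annulus t)) ?_
    (Set.subset_union_left.trans Set.subset_union_left) Set.subset_union_right hs hs2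
    (fun z hz => hz.elim (hRV z) (hRA z)) hRc (fun z hz => ?_) (fun z hz => ?_)
  · refine ⟨⟨0, Or.inl (Or.inl (by simpa using hr0))⟩, ?_⟩
    have hmem : Complex.exp (φ * Complex.I) ∈ V ∩ annulus t := by
      rw [hmeet]
      exact ⟨_, ⟨⟨by simpa using hlt, by simpa using hlt⟩, by simpa using hε⟩, rfl⟩
    exact hVc.union _ hmem.1 hmem.2 (isPreconnected_annulus ht0)
  · rw [heq z hz]
    simp only [hR, blaschkeFactor_eq (hden z hz _)]
  · have hev : (fun z => c * ∏ j, (α j ^ 2 - z ^ 2) / (1 - conj (α j) ^ 2 * z ^ 2)) =ᶠ[𝓝 z] R := by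
      have : ∀ᶠ w in 𝓝 z, ∀ j, 1 - conj (α j) ^ 2 * w ^ 2 ≠ 0 := eventually_all.2 fun j =>
        ContinuousAt.eventually_ne (g := fun w => 1 - conj (α j) ^ 2 * w ^ 2) (by fun_prop)
          (hden z hz j)
      filter_upwards [this] with w hw
      simp only [hR, blaschkeFactor_eq (hw _)]
    refine ContinuousAt.congr ?_ hev
    refine ContinuousAt.const_mul (tendsto_finsetProd _ fun j _ => ?_) c
    exact ContinuousAt.div (by fun_prop) (by fun_prop) (hden z hz j)

end CylinderDressing

theorem mainTheorem8 (n : ℕ∞) (r : ℝ) (hr0 : 0 < r) (hr1 : r ≤ 1) (q : ℂ) (hq : q ≠ 0)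
    (a : ℂ → ℂ) (ha : CylinderDressing.diagLoop a ∈ CylinderDressing.LambdaPlus n r) :
    (CylinderDressing.ExtendsUnitarily r (CylinderDressing.diagLoop a) ∧
      (fun l => CylinderDressing.diagLoop a l * CylinderDressing.cylinderMonodromy q l *
        (CylinderDressing.diagLoop a l)⁻¹) ∈ CylinderDressing.LambdaPuncturedSU r) ↔
    ∃ (N : ℕ) (α : Fin N → ℂ) (c : ℂ), ‖c‖ = 1 ∧
      (∀ j, α j ∈ CylinderDressing.spectralSet r q) ∧
      Function.Injective (fun j => α j ^ 2) ∧
      ∀ l ∈ Metric.sphere (0 : ℂ) r,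
        a l ^ 2 = c * ∏ j, (α j ^ 2 - l ^ 2) / (1 - (starRingEnd ℂ) (α j) ^ 2 * l ^ 2) := by
  constructor
  · rintro ⟨hext, hmem⟩
    exact CylinderDressing.exists_blaschke_of_dressing hr0 hr1 hq ha hext hmem
  · rintro ⟨N, α, c, hc, hα, hinj, heq⟩
    exact ⟨CylinderDressing.extendsUnitarily_of_blaschke hr0 hr1 hc (fun j => (hα j).1) ha heq,
      CylinderDressing.mem_punctured_of_blaschke hr0 hc hα hinj
        (fun z hz => CylinderDressing.ne_zero_of_isTwistedLoop_diagLoop ha.1 hz) heq⟩
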